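/- Let $d\ge 0$ be an integer. The Hamming digraph $H^*(d,3)$ has vertex set $X=\mathbb F_3^d$, with an arc from $x$ to $y$ exactly when $x$ and $y$ differ in exactly one coordinate $i$ and $x_i+1=y_i$ for that $i$. Let $A\in \mathrm{Mat}_X(\mathbb C)$ be its adjacency matrix, so $A_{x,y}=1$ if there is an arc from $x$ to $y$ and $A_{x,y}=0$ otherwise. Let $\partial(x,y)$ be the smallest number of arcs in a directed path from $x$ to $y$, let $\tilde\partial(x,y)=(\partial(x,y),\partial(y,x))$, and let $\Delta=\{\tilde\partial(x,y) : x,y\in X\}$. For a base vertex $x\in X$ and $(i,j)\in\Delta$, let $E^*_{i,j}\in\mathrm{Mat}_X(\mathbb C)$ be the diagonal matrix whose $(z,z)$ entry is $1$ if $\tilde\partial(x,z)=(i,j)$ and $0$ otherwise. The Terwilliger algebra $\mathcal T(x)$ is the $\mathbb C$-subalgebra of $\mathrm{Mat}_X(\mathbb C)$ generated by $A$, $A^{\top}$ and all $E^*_{i,j}$ with $(i,j)\in\Delta$. Let $\mathrm{Sym}^{(d)}(\mathrm{Mat}_3(\mathbb C))$ be the subalgebra of $\mathrm{Mat}_3(\mathbb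 C)^{\otimes d}$ consisting of the tensors fixed by all permutations of the $d$ tensor factors. **Theorem.** For every base vertex $x\in X$ there are isomorphisms of $\mathbb C$-algebras $$\mathcal T(x)\;\simeq\;\mathrm{Sym}^{(d)}(\mathrm{Mat}_3(\mathbb C))\;\simeq\;\bigoplus_{\ell=0}^{\lfloor d/3\rfloor}\ \bigoplus_{m=0}^{\lfloor (d-3\ell)/2\rfloor}\mathrm{Mat}_{n_{\ell,m}}(\mathbb C),$$ where $$n_{\ell,m}=\tfrac12\,(d-3\ell-2m+1)(m+1)(d-3\ell-m+2).$$ There is one summand for each pair $(\ell,m)$, even when different pairs give the same size $n_{\ell,m}$. -/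

import Mathlib

open scoped TensorProduct

namespace HammingDigraph

section Digraphs

variable {V : Type*} (G : Digraph V)

/-- `HasWalk G n x y`: there is a directed walk with exactly `n` arcs from `x` to `y`. -/
def HasWalk : ℕ → V → V → Prop
  | 0, x, y => x = y
  | n + 1, x, y => ∃ z, G.Adj x z ∧ HasWalk n z y

/-- The directed distance `∂(x, y)`: the smallest number of arcs in a directed walk from `x` to `y`
(used only for strongly connected digraphs, where such a walk always exists). -/
noncomputable def dist (x y : V) : ℕ := sInf {n | HasWalk G n x y}

/-- The two-way distance `(∂(x, y), ∂(y, x))`. -/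
noncomputable def twoWayDist (x y : V) : ℕ × ℕ := (dist G x y, dist G y x)

/-- The set `Δ` of all two-way distances. -/
def twoWayDistSet : Set (ℕ × ℕ) := {p | ∃ x y : V, twoWayDist G x y = p}

open Classical in
/-- The adjacency matrix over `ℂ`: the entry at `(x, y)` is `1` if there is an arc from `x` to `y`
and `0` otherwise. -/
noncomputable def adjMatrix : Matrix V V ℂ :=
  Matrix.of fun x y => if G.Adj x y then 1 else 0

/-- The diagonal matrix `E*_{i,j}` with respect to the base vertex `x`, where `p = (i, j)`: its
`(z, z)` entry is `1` if the two-way distance from `x` to `z` is `(i, j)` and `0` otherwise. -/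
noncomputable def dualIdempotent [DecidableEq V] (x : V) (p : ℕ × ℕ) : Matrix V V ℂ :=
  Matrix.diagonal fun z => if twoWayDist G x z = p then 1 else 0

/-- The Terwilliger algebra with respect to the base vertex `x`: the `ℂ`-algebra of matrices
generated by `A`, `Aᵀ` and all `E*_{i,j}` with `(i, j) ∈ Δ`. -/
noncomputable def terwilligerAlgebra [Fintype V] [DecidableEq V] (x : V) :
    Subalgebra ℂ (Matrix V V ℂ) :=
  Algebra.adjoin ℂ
    ({adjMatrix G, (adjMatrix G).transpose} ∪ dualIdempotent G x '' twoWayDistSet G)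

end Digraphs

/-- The Hamming digraph `H*(d, 3)`: there is an arc from `x` to `y` exactly when `x` and `y` differ
in a single coordinate `i`, and `x i + 1 = y i` there. -/
def hammingDigraph (d : ℕ) : Digraph (Fin d → ZMod 3) where
  Adj x y := ∃ i, x i + 1 = y i ∧ ∀ j, j ≠ i → x j = y j

/-- The `d`-fold tensor power of `Mat_3(ℂ)`, with its factorwise multiplication. -/
abbrev TensorPower (d : ℕ) : Type := ⨂[ℂ] _ : Fin d, Matrix (Fin 3) (Fin 3) ℂ

/-- The permutation of the tensor factors by `σ`. -/
noncomputable def permTensor {d : ℕ} (σ : Equiv.Perm (Fin d)) :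
    TensorPower d ≃ₗ[ℂ] TensorPower d :=
  PiTensorProduct.reindex ℂ (fun _ => Matrix (Fin 3) (Fin 3) ℂ) σ

theorem permTensor_tprod {d : ℕ} (σ : Equiv.Perm (Fin d))
    (f : Fin d → Matrix (Fin 3) (Fin 3) ℂ) :
    permTensor σ (PiTensorProduct.tprod ℂ f) = PiTensorProduct.tprod ℂ (fun i => f (σ.symm i)) :=
  PiTensorProduct.reindex_tprod (s := fun _ => Matrix (Fin 3) (Fin 3) ℂ) σ f

theorem permTensor_one {d : ℕ} (σ : Equiv.Perm (Fin d)) :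
    permTensor σ (1 : TensorPower d) = 1 :=
  permTensor_tprod σ 1

theorem permTensor_mul {d : ℕ} (σ : Equiv.Perm (Fin d)) (a b : TensorPower d) :
    permTensor σ (a * b) = permTensor σ a * permTensor σ b := by
  induction a using PiTensorProduct.induction_on with
  | smul_tprod r f =>
    induction b using PiTensorProduct.induction_on with
    | smul_tprod s g =>
      rw [PiTensorProduct.smul_tprod_mul_smul_tprod, map_smul, map_smul, map_smul,
        permTensor_tprod, permTensor_tprod, permTensor_tprod,
        PiTensorProduct.smul_tprod_mul_smul_tprod]
      rfl
    | add x y hx hy => simp only [mul_add, map_add, hx, hy]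
  | add x y hx hy => simp only [add_mul, map_add, hx, hy]

/-- The symmetric tensor algebra `Sym^(d)(Mat_3(ℂ))`: the subalgebra of `Mat_3(ℂ)^{⊗ d}` of all
symmetric tensors, that is, those fixed by every permutation of the tensor factors. -/
noncomputable def symTensorAlgebra (d : ℕ) : Subalgebra ℂ (TensorPower d) where
  carrier := {t | ∀ σ : Equiv.Perm (Fin d), permTensor σ t = t}
  mul_mem' ha hb σ := by rw [permTensor_mul, ha σ, hb σ]
  add_mem' ha hb σ := by rw [map_add, ha σ, hb σ]
  algebraMap_mem' r σ := by
    rw [Algebra.algebraMap_eq_smul_one, map_smul, permTensor_one]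

/-- The index set of the blocks: pairs `(ℓ, m)` with `0 ≤ ℓ ≤ ⌊d / 3⌋` and
`0 ≤ m ≤ ⌊(d - 3ℓ) / 2⌋`. -/
abbrev BlockIndex (d : ℕ) : Type :=
  (l : Fin (d / 3 + 1)) × Fin ((d - 3 * (l : ℕ)) / 2 + 1)

/-- The size `(d - 3ℓ - 2m + 1)(m + 1)(d - 3ℓ - m + 2) / 2` of the block indexed by `(ℓ, m)`. -/
def blockSize (d : ℕ) (p : BlockIndex d) : ℕ :=
  (d - 3 * (p.1 : ℕ) - 2 * (p.2 : ℕ) + 1) * ((p.2 : ℕ) + 1) *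
    (d - 3 * (p.1 : ℕ) - (p.2 : ℕ) + 2) / 2

/-- No subtraction in `blockSize` truncates, and its division by `2` is exact. -/
theorem blockSize_cast (d : ℕ) (p : BlockIndex d) :
    (blockSize d p : ℚ) =
      1 / 2 * (d - 3 * (p.1 : ℕ) - 2 * (p.2 : ℕ) + 1) * ((p.2 : ℕ) + 1) *
        (d - 3 * (p.1 : ℕ) - (p.2 : ℕ) + 2) := by
  obtain ⟨⟨l, hl⟩, ⟨m, hm⟩⟩ := p
  obtain ⟨k, rfl⟩ : ∃ k, d = 3 * l + 2 * m + k :=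
    ⟨d - 3 * l - 2 * m, by simp only at hm; omega⟩
  have h1 : 3 * l + 2 * m + k - 3 * l - 2 * m = k := by omega
  have h2 : 3 * l + 2 * m + k - 3 * l - m = m + k := by omega
  have hdvd : 2 ∣ (k + 1) * (m + 1) * (m + k + 2) := by
    rcases Nat.even_or_odd' k with ⟨a, rfl | rfl⟩
    · rcases Nat.even_or_odd' m with ⟨b, rfl | rfl⟩
      · exact Dvd.dvd.mul_left ⟨a + b + 1, by ring⟩ _
      · exact Dvd.dvd.mul_right (Dvd.dvd.mul_left ⟨b + 1, by ring⟩ _) _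
    · exact Dvd.dvd.mul_right (Dvd.dvd.mul_right ⟨a + 1, by ring⟩ _) _
  simp only [blockSize, h1, h2]
  rw [Nat.cast_div hdvd (by norm_num)]
  push_cast
  ring

end HammingDigraph

/-! After translating the base vertex to zero, the Terwilliger algebra becomes the algebra S of all
matrices on words over {0,1,2} that are invariant under permuting positions; the Kronecker product
identifies S with the symmetric tensors. The generators clearly lie in S. Conversely, S is generated
by the operators `positionSum d M`, the action of gl_3 on the tensor power (`symMatrixAlgebra_le`).
The adjacency matrix and its transpose are the actions of the cyclic shift and its transpose, the
dual idempotents supply the actions of all diagonal matrices, and these together generate gl_3 as a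
Lie algebra.

The blocks come from Weyl modules. For a diagram with l, m, k columns of height 3, 2, 1, let W be
the S-module generated by the polytabloid. Its elements alternate along columns, so they vanish on
words of energy below that of the row word, and at this minimal energy they live on column
rearrangements of it. Hence the projection onto the content of the row word acts on W with rank one
(`IsAlt.weightProj_mulVec`). Positivity of the Hermitian form then gives surjectivity of S onto End
W, and induction on energy gives surjectivity onto the product of these algebras over all diagrams
(`pi_weylRep_surjective`).

A dimension count finishes: S has dimension at most C(d+8, 8), each W has dimension at least the
block size, and the squares of the block sizes add up to C(d+8, 8). So every inequality is an
equality. -/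

namespace HammingDigraph

/-! ### Symmetric tensors as permutation-invariant matrices -/

/-- The Kronecker product of a family of `3 × 3` matrices, indexed by words of length `d`. -/
noncomputable def kron {d : ℕ} (f : Fin d → Matrix (Fin 3) (Fin 3) ℂ) :
    Matrix (Fin d → Fin 3) (Fin d → Fin 3) ℂ :=
  Matrix.of fun z w => ∏ i, f i (z i) (w i)

theorem kron_apply {d : ℕ} (f : Fin d → Matrix (Fin 3) (Fin 3) ℂ) (z w : Fin d → Fin 3) :
    kron f z w = ∏ i, f i (z i) (w i) := rfl

theorem kron_mul {d : ℕ} (f g : Fin d → Matrix (Fin 3) (Fin 3) ℂ) :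
    kron f * kron g = kron (f * g) := by
  ext z w
  simp only [Matrix.mul_apply, kron_apply, Pi.mul_apply, ← Finset.prod_mul_distrib,
    Finset.prod_univ_sum, Fintype.piFinset_univ]

theorem kron_one {d : ℕ} : kron (1 : Fin d → Matrix (Fin 3) (Fin 3) ℂ) = 1 := by
  ext z w
  simp only [kron_apply, Pi.one_apply, Matrix.one_apply, Finset.prod_ite_zero, Finset.prod_const_one,
    Finset.mem_univ, forall_true_left, funext_iff]

theorem kron_update_apply {d : ℕ} [DecidableEq (Fin d)] (f : Fin d → Matrix (Fin 3) (Fin 3) ℂ)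
    (i : Fin d) (c : Matrix (Fin 3) (Fin 3) ℂ) (z w : Fin d → Fin 3) :
    kron (Function.update f i c) z w =
      c (z i) (w i) * ∏ j ∈ Finset.univ.erase i, f j (z j) (w j) := by
  rw [kron_apply, ← Finset.mul_prod_erase _ _ (Finset.mem_univ i), Function.update_self]
  congr 1
  refine Finset.prod_congr rfl fun j hj => ?_
  rw [Function.update_of_ne (Finset.ne_of_mem_erase hj)]

/-- The Kronecker product as a multilinear map. -/
noncomputable def kronMultilinear (d : ℕ) :
    MultilinearMap ℂ (fun _ : Fin d => Matrix (Fin 3) (Fin 3) ℂ)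
      (Matrix (Fin d → Fin 3) (Fin d → Fin 3) ℂ) where
  toFun := kron
  map_update_add' f i a b := by
    ext z w
    simp only [Matrix.add_apply, kron_update_apply, add_mul]
  map_update_smul' f i a b := by
    ext z w
    simp only [Matrix.smul_apply, kron_update_apply, smul_eq_mul, mul_assoc]

/-- The algebra homomorphism from the tensor power to matrices indexed by words. -/
noncomputable def kronHom (d : ℕ) : TensorPower d →ₐ[ℂ] Matrix (Fin d → Fin 3) (Fin d → Fin 3) ℂ :=
  PiTensorProduct.liftAlgHom (kronMultilinear d) kron_one fun f g => (kron_mul f g).symm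

theorem kronHom_tprod {d : ℕ} (f : Fin d → Matrix (Fin 3) (Fin 3) ℂ) :
    kronHom d (PiTensorProduct.tprod ℂ f) = kron f :=
  PiTensorProduct.lift.tprod _

theorem kron_single {d : ℕ} (z w : Fin d → Fin 3) :
    kron (fun i => Matrix.single (z i) (w i) (1 : ℂ)) = Matrix.single z w 1 := by
  ext a b
  simp only [kron_apply, Matrix.single_apply, Finset.prod_ite_zero, Finset.prod_const_one,
    Finset.mem_univ, forall_true_left, funext_iff, forall_and]

theorem kronHom_surjective (d : ℕ) : Function.Surjective (kronHom d) := by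
  intro M
  induction M using Matrix.induction_on' with
  | h_zero => exact ⟨0, map_zero _⟩
  | h_add p q hp hq =>
    obtain ⟨a, rfl⟩ := hp
    obtain ⟨b, rfl⟩ := hq
    exact ⟨a + b, map_add _ _ _⟩
  | h_std_basis z w c =>
    refine ⟨c • PiTensorProduct.tprod ℂ (fun i => Matrix.single (z i) (w i) (1 : ℂ)), ?_⟩
    rw [map_smul, kronHom_tprod, kron_single, Matrix.smul_single, smul_eq_mul, mul_one]

theorem kronHom_bijective (d : ℕ) : Function.Bijective (kronHom d) := by
  have b := Basis.piTensorProduct (R := ℂ) (ι := Fin d)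
    (fun _ => Matrix.stdBasis ℂ (Fin 3) (Fin 3))
  have hd : Module.finrank ℂ (TensorPower d) =
      Module.finrank ℂ (Matrix (Fin d → Fin 3) (Fin d → Fin 3) ℂ) := by
    rw [Module.finrank_eq_card_basis b, Module.finrank_matrix]
    simp [← mul_pow]
  have : Module.Finite ℂ (TensorPower d) := Module.Finite.of_basis b
  have hs := kronHom_surjective d
  exact ⟨(LinearMap.injective_iff_surjective_of_finrank_eq_finrank hd
    (f := (kronHom d).toLinearMap)).2 hs, hs⟩

/-- The algebra of matrices indexed by words that are invariant under permuting positions. -/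
def symMatrixAlgebra (d : ℕ) : Subalgebra ℂ (Matrix (Fin d → Fin 3) (Fin d → Fin 3) ℂ) where
  carrier := {M | ∀ (σ : Equiv.Perm (Fin d)) z w, M (z ∘ σ) (w ∘ σ) = M z w}
  mul_mem' {a b} ha hb σ z w := by
    rw [Matrix.mul_apply, Matrix.mul_apply,
      ← Equiv.sum_comp (σ.symm.arrowCongr (Equiv.refl (Fin 3)))]
    refine Finset.sum_congr rfl fun u _ => ?_
    rw [← ha σ z u, ← hb σ u w]
    rfl
  add_mem' ha hb σ z w := by rw [Matrix.add_apply, ha, hb, Matrix.add_apply]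
  algebraMap_mem' r σ z w := by
    simp only [Matrix.algebraMap_matrix_apply, σ.surjective.injective_comp_right.eq_iff]

theorem kronHom_permTensor {d : ℕ} (σ : Equiv.Perm (Fin d)) (t : TensorPower d)
    (z w : Fin d → Fin 3) :
    kronHom d (permTensor σ t) z w = kronHom d t (z ∘ σ) (w ∘ σ) := by
  induction t using PiTensorProduct.induction_on with
  | smul_tprod r f =>
    rw [map_smul, map_smul, map_smul, permTensor_tprod, kronHom_tprod, kronHom_tprod,
      Matrix.smul_apply, Matrix.smul_apply, kron_apply, kron_apply, ← Equiv.prod_comp σ]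
    simp
  | add x y hx hy => simp only [map_add, Matrix.add_apply, hx, hy]

/-- Symmetric tensors correspond to permutation-invariant matrices. -/
noncomputable def symTensorEquiv (d : ℕ) : symTensorAlgebra d ≃ₐ[ℂ] symMatrixAlgebra d :=
  AlgEquiv.ofBijective
    (((kronHom d).comp (symTensorAlgebra d).val).codRestrict (symMatrixAlgebra d) fun t σ z w => by
      change kronHom d t.1 _ _ = kronHom d t.1 _ _
      rw [← kronHom_permTensor, t.2 σ])
    ⟨fun a b h => Subtype.ext ((kronHom_bijective d).1 (congrArg Subtype.val h)), fun M => by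
      obtain ⟨t, ht⟩ := (kronHom_bijective d).2 M.1
      refine ⟨⟨t, fun σ => (kronHom_bijective d).1 ?_⟩, Subtype.ext ht⟩
      ext z w
      rw [kronHom_permTensor, ht, M.2 σ]⟩

/-! ### Generation of the invariant matrices by position sums -/

/-- The sum over all positions of the matrix `M` acting in that position. -/
noncomputable def positionSum (d : ℕ) (M : Matrix (Fin 3) (Fin 3) ℂ) :
    Matrix (Fin d → Fin 3) (Fin d → Fin 3) ℂ :=
  ∑ i, kron (Pi.mulSingle i M)

theorem positionSum_add {d : ℕ} (M N : Matrix (Fin 3) (Fin 3) ℂ) :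
    positionSum d (M + N) = positionSum d M + positionSum d N := by
  rw [positionSum, positionSum, positionSum, ← Finset.sum_add_distrib]
  exact Finset.sum_congr rfl fun i _ => (kronMultilinear d).map_update_add 1 i M N

theorem positionSum_smul {d : ℕ} (c : ℂ) (M : Matrix (Fin 3) (Fin 3) ℂ) :
    positionSum d (c • M) = c • positionSum d M := by
  rw [positionSum, positionSum, Finset.smul_sum]
  exact Finset.sum_congr rfl fun i _ => (kronMultilinear d).map_update_smul 1 i c M

/-- `positionSum` as a linear map. -/
noncomputable def positionSumLinear (d : ℕ) : Matrix (Fin 3) (Fin 3) ℂ →ₗ[ℂ]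
    Matrix (Fin d → Fin 3) (Fin d → Fin 3) ℂ where
  toFun := positionSum d
  map_add' := positionSum_add
  map_smul' := positionSum_smul

/-- Matrices acting in different positions commute, so only the terms with both factors in the same
position survive. -/
theorem positionSum_lie {d : ℕ} (M N : Matrix (Fin 3) (Fin 3) ℂ) :
    positionSum d M * positionSum d N - positionSum d N * positionSum d M =
      positionSum d (M * N - N * M) := by
  have h : positionSum d (M * N - N * M) = positionSum d (M * N) - positionSum d (N * M) :=
    (positionSumLinear d).map_sub _ _
  rw [h]
  simp only [positionSum, Finset.sum_mul, Finset.mul_sum, kron_mul]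
  rw [Finset.sum_comm (γ := Fin d), ← Finset.sum_sub_distrib, ← Finset.sum_sub_distrib]
  refine Finset.sum_congr rfl fun i _ => ?_
  rw [← Finset.sum_sub_distrib, Finset.sum_eq_single i]
  · rw [Pi.mulSingle_mul, Pi.mulSingle_mul]
  · intro j _ hj
    rw [(Pi.mulSingle_commute (f := fun _ => Matrix (Fin 3) (Fin 3) ℂ) hj.symm M N).eq, sub_self]
  · simp

/-- The sum of `kron` over all ways to place the matrices `M j` in distinct positions. -/
noncomputable def placementSum {d k : ℕ} (M : Fin k → Matrix (Fin 3) (Fin 3) ℂ) :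
    Matrix (Fin d → Fin 3) (Fin d → Fin 3) ℂ :=
  ∑ φ : Fin k ↪ Fin d, kron (Function.extend φ M 1)

/-- In the product, `N` either falls on a position not used by the placement, which extends the
injection by one, or on the position of some `M j`, which it multiplies. -/
theorem placementSum_cons {d k : ℕ} (N : Matrix (Fin 3) (Fin 3) ℂ)
    (M : Fin k → Matrix (Fin 3) (Fin 3) ℂ) :
    positionSum d N * placementSum M = placementSum (Fin.cons N M) +
      ∑ j, placementSum (Function.update M j (N * M j)) := by
  classical
  simp only [placementSum]
  rw [← Equiv.sum_comp (Equiv.embeddingFinSucc k (Fin d)).symm, Fintype.sum_sigma,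
    Finset.sum_comm (γ := Fin k), ← Finset.sum_add_distrib, Finset.mul_sum]
  refine Finset.sum_congr rfl fun φ _ => ?_
  rw [positionSum, Finset.sum_mul]
  simp only [kron_mul]
  rw [← Fintype.sum_subtype_add_sum_subtype (fun i => i ∉ Set.range φ)]
  congr 1
  · refine Finset.sum_congr rfl fun i _ => congrArg kron ?_
    set e := (Equiv.embeddingFinSucc k (Fin d)).symm ⟨φ, i⟩ with he
    have hφ : (Equiv.embeddingFinSucc k (Fin d)) e = ⟨φ, i⟩ := by simp [he]
    have h0 : e 0 = i := by
      rw [← Equiv.embeddingFinSucc_snd, hφ]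
    have hs (j : Fin k) : e j.succ = φ j := by
      have := Equiv.embeddingFinSucc_fst e
      rw [hφ] at this
      exact (congrFun this j).symm
    funext x
    by_cases hx : ∃ j, e j = x
    · obtain ⟨j, rfl⟩ := hx
      rw [e.injective.extend_apply]
      refine Fin.cases ?_ (fun j => ?_) j
      · have : Function.extend φ M 1 (e 0) = 1 := by
          rw [Function.extend_apply' _ _ _ (by rw [h0]; exact i.2)]; rfl
        rw [h0] at this
        simp [this, h0]
      · have hne : e j.succ ≠ i := by
          rw [← h0]; exact e.injective.ne (Fin.succ_ne_zero j)
        simp [hs, φ.injective.extend_apply, Pi.mulSingle_eq_of_ne (hs j ▸ hne)]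
    · rw [Function.extend_apply' _ _ _ hx, Pi.mul_apply, Pi.mulSingle_eq_of_ne,
        Function.extend_apply']
      · simp
      · rintro ⟨j, rfl⟩
        exact hx ⟨j.succ, hs j⟩
      · rintro rfl
        exact hx ⟨0, h0⟩
  · rw [← Equiv.sum_comp ((Equiv.ofInjective φ φ.injective).trans
      (Equiv.subtypeEquivRight fun i => by simp : Set.range φ ≃ {i // ¬ i ∉ Set.range φ}))]
    refine Finset.sum_congr rfl fun j _ => congrArg kron ?_
    change (Pi.mulSingle (φ j) N : Fin d → Matrix (Fin 3) (Fin 3) ℂ) * _ = _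
    funext x
    by_cases hx : ∃ j, φ j = x
    · obtain ⟨l, rfl⟩ := hx
      rw [Pi.mul_apply, φ.injective.extend_apply, φ.injective.extend_apply]
      obtain rfl | hl := eq_or_ne l j
      · simp
      · rw [Pi.mulSingle_eq_of_ne (φ.injective.ne hl), Function.update_of_ne hl, one_mul]
    · rw [Function.extend_apply' _ _ _ hx, Pi.mul_apply, Function.extend_apply' _ _ _ hx,
        Pi.mulSingle_eq_of_ne (fun h => hx ⟨j, h.symm⟩), one_mul]

/-- `placementSum_cons`, solved for its first term on the right, reduces `k + 1` placed matrices to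
`k`. -/
theorem placementSum_mem {d : ℕ} {B : Subalgebra ℂ (Matrix (Fin d → Fin 3) (Fin d → Fin 3) ℂ)}
    (hB : ∀ M, positionSum d M ∈ B) {k : ℕ} (M : Fin k → Matrix (Fin 3) (Fin 3) ℂ) :
    placementSum M ∈ B := by
  induction k with
  | zero =>
    have h : ∀ φ : Fin 0 ↪ Fin d, kron (Function.extend φ M 1) = 1 := fun φ => by
      rw [← kron_one]
      exact congrArg kron (funext fun x => Function.extend_apply' _ _ _ fun ⟨j, _⟩ => j.elim0)
    simp only [placementSum, h]
    exact sum_mem fun _ _ => one_mem B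
  | succ k ih =>
    have h := placementSum_cons (d := d) (M 0) (Fin.tail M)
    rw [Fin.cons_self_tail, ← sub_eq_iff_eq_add] at h
    rw [← h]
    exact sub_mem (mul_mem (hB _) (ih _)) (sum_mem fun j _ => ih _)

/-- The algebra of permutation-invariant matrices is generated by the matrices `positionSum d M`. -/
theorem symMatrixAlgebra_le {d : ℕ} {B : Subalgebra ℂ (Matrix (Fin d → Fin 3) (Fin d → Fin 3) ℂ)}
    (hB : ∀ M, positionSum d M ∈ B) : symMatrixAlgebra d ≤ B := by
  intro M hM
  -- For `k = d` a placement is a permutation of the positions. Expanding `M` in matrix units, each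
  -- of the `d!` permutations returns `M` itself by invariance.
  have key : (d.factorial : ℂ) • M = ∑ z, ∑ w, M z w •
      placementSum (d := d) (fun i => Matrix.single (z i) (w i) (1 : ℂ)) := by
    simp only [placementSum, Finset.smul_sum]
    rw [Finset.sum_congr rfl fun z _ => Finset.sum_comm, Finset.sum_comm,
      Finset.sum_congr rfl (g := fun _ => M) fun φ _ => ?_]
    · rw [Finset.sum_const, Finset.card_univ, Fintype.card_embedding_eq, Fintype.card_fin,
        Nat.descFactorial_self, Nat.cast_smul_eq_nsmul]
    · obtain ⟨σ, rfl⟩ := (Equiv.embeddingEquivOfFinite (Fin d)).symm.surjective φ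
      have hk (z w : Fin d → Fin 3) : kron (Function.extend
          ((Equiv.embeddingEquivOfFinite (Fin d)).symm σ)
          (fun i => Matrix.single (z i) (w i) (1 : ℂ)) 1) =
          Matrix.single (z ∘ σ.symm) (w ∘ σ.symm) 1 := by
        rw [← kron_single]
        congr 1
        funext x
        obtain ⟨y, rfl⟩ := σ.surjective x
        have := ((Equiv.embeddingEquivOfFinite (Fin d)).symm σ).injective.extend_apply
          (fun i => Matrix.single (z i) (w i) (1 : ℂ)) 1 y
        simpa using this
      simp only [hk]
      have hM' (z w : Fin d → Fin 3) : M z w = M (z ∘ σ.symm) (w ∘ σ.symm) :=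
        (hM σ.symm z w).symm
      conv_rhs => rw [Matrix.matrix_eq_sum_single M]
      conv_rhs => rw [← Equiv.sum_comp (σ.arrowCongr (Equiv.refl (Fin 3)))]
      refine Finset.sum_congr rfl fun z _ => ?_
      conv_rhs => rw [← Equiv.sum_comp (σ.arrowCongr (Equiv.refl (Fin 3)))]
      refine Finset.sum_congr rfl fun w _ => ?_
      rw [hM' z w, Matrix.smul_single, smul_eq_mul, mul_one]
      rfl
  have h2 : M = (d.factorial : ℂ)⁻¹ • ((d.factorial : ℂ) • M) := by
    rw [smul_smul, inv_mul_cancel₀ (Nat.cast_ne_zero.2 d.factorial_ne_zero), one_smul]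
  rw [h2, key]
  exact B.smul_mem (sum_mem fun z _ => sum_mem fun w _ => B.smul_mem (placementSum_mem hB _) _) _

/-! ### Distances in the Hamming digraph -/

/-- An arc adds 1 to one coordinate, which lowers the residue of `z i - x i` by at most 1. -/
theorem sum_val_le_of_hasWalk {d n : ℕ} {x z : Fin d → ZMod 3}
    (h : HasWalk (hammingDigraph d) n x z) : ∑ i, (z i - x i).val ≤ n := by
  induction n generalizing x with
  | zero => 
    obtain rfl : x = z := h
    simp
  | succ n ih =>
    obtain ⟨y, ⟨i, hi, hj⟩, hy⟩ := h
    have h1 := ih hy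
    rw [← Finset.add_sum_erase _ _ (Finset.mem_univ i)] at h1 ⊢
    have h2 : ∑ j ∈ Finset.univ.erase i, (z j - x j).val =
        ∑ j ∈ Finset.univ.erase i, (z j - y j).val :=
      Finset.sum_congr rfl fun j hj' => by rw [hj j (Finset.ne_of_mem_erase hj')]
    have h3 : ∀ a b : ZMod 3, (b - a).val ≤ (b - (a + 1)).val + 1 := by decide
    have h4 := h3 (x i) (z i)
    rw [hi] at h4
    omega

theorem hasWalk_sum_val {d : ℕ} (x z : Fin d → ZMod 3) :
    HasWalk (hammingDigraph d) (∑ i, (z i - x i).val) x z := by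
  induction hn : ∑ i, (z i - x i).val generalizing x with
  | zero =>
    funext i
    have := Finset.sum_eq_zero_iff.1 hn i (Finset.mem_univ i)
    rw [ZMod.val_eq_zero, sub_eq_zero] at this
    exact this.symm
  | succ n ih =>
    obtain ⟨i, hi⟩ : ∃ i, (z i - x i).val ≠ 0 := by
      by_contra! h
      simp [h] at hn
    refine ⟨Function.update x i (x i + 1), ⟨i, by simp, fun j hj => by simp [hj]⟩, ih _ ?_⟩
    rw [← Finset.add_sum_erase _ _ (Finset.mem_univ i)] at hn ⊢
    have h2 : ∑ j ∈ Finset.univ.erase i, (z j - Function.update x i (x i + 1) j).val =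
        ∑ j ∈ Finset.univ.erase i, (z j - x j).val :=
      Finset.sum_congr rfl fun j hj' => by rw [Function.update_of_ne (Finset.ne_of_mem_erase hj')]
    have h3 : ∀ a b : ZMod 3, (b - a).val ≠ 0 → (b - a).val = (b - (a + 1)).val + 1 := by decide
    have h4 := h3 _ _ hi
    rw [h2, Function.update_self]
    omega

theorem dist_hammingDigraph {d : ℕ} (x z : Fin d → ZMod 3) :
    dist (hammingDigraph d) x z = ∑ i, (z i - x i).val :=
  le_antisymm (Nat.sInf_le (hasWalk_sum_val x z))
    (le_csInf ⟨_, hasWalk_sum_val x z⟩ fun _ h => sum_val_le_of_hasWalk h)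

/-! ### Entries of position sums, and Lie generators of gl_3 -/

theorem positionSum_apply {d : ℕ} (M : Matrix (Fin 3) (Fin 3) ℂ) (z w : Fin d → Fin 3) :
    positionSum d M z w = ∑ i, if ∀ j, j ≠ i → z j = w j then M (z i) (w i) else 0 := by
  rw [positionSum, Matrix.sum_apply]
  refine Finset.sum_congr rfl fun i _ => ?_
  rw [Pi.mulSingle, kron_update_apply]
  simp only [Pi.one_apply, Matrix.one_apply, Finset.prod_ite_zero, Finset.prod_const_one,
    Finset.mem_erase, Finset.mem_univ, and_true, mul_ite, mul_one, mul_zero]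

theorem positionSum_diagonal {d : ℕ} (f : Fin 3 → ℂ) :
    positionSum d (Matrix.diagonal f) = Matrix.diagonal fun z => ∑ i, f (z i) := by
  ext z w
  rw [positionSum_apply, Matrix.diagonal_apply]
  split_ifs with h
  · subst h; simp
  · refine Finset.sum_eq_zero fun i _ => ?_
    split_ifs with h1
    · refine Matrix.diagonal_apply_ne _ fun h2 => h (funext fun j => ?_)
      obtain rfl | hj := eq_or_ne j i
      exacts [h2, h1 j hj]
    · rfl

theorem positionSum_mem_symMatrixAlgebra {d : ℕ} (M : Matrix (Fin 3) (Fin 3) ℂ) :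
    positionSum d M ∈ symMatrixAlgebra d := by
  intro σ z w
  rw [positionSum_apply, positionSum_apply]
  conv_rhs => rw [← Equiv.sum_comp σ]
  refine Finset.sum_congr rfl fun i _ => ?_
  have h : (∀ j, j ≠ i → (z ∘ σ) j = (w ∘ σ) j) ↔ ∀ j, j ≠ σ i → z j = w j :=
    ⟨fun h j hj => by
      simpa using h (σ.symm j) fun h' => hj (by rw [← h', Equiv.apply_symm_apply]),
      fun h j hj => h _ (σ.injective.ne hj)⟩
  simp only [h]
  rfl

/-- The cyclic shift matrix. -/
def shiftMatrix : Matrix (Fin 3) (Fin 3) ℂ := Matrix.of fun a b => if a + 1 = b then 1 else 0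

/-- The Lie algebra of all `3 × 3` matrices is generated by the diagonal matrices, the cyclic shift
and its transpose. -/
theorem positionSum_mem_of_diagonal {d : ℕ}
    {B : Subalgebra ℂ (Matrix (Fin d → Fin 3) (Fin d → Fin 3) ℂ)}
    (h1 : ∀ f, positionSum d (Matrix.diagonal f) ∈ B) (h2 : positionSum d shiftMatrix ∈ B)
    (h3 : positionSum d shiftMatrix.transpose ∈ B) (M : Matrix (Fin 3) (Fin 3) ℂ) :
    positionSum d M ∈ B := by
  let L : Submodule ℂ (Matrix (Fin 3) (Fin 3) ℂ) :=
    (Subalgebra.toSubmodule B).comap (positionSumLinear d)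
  have hL {M N : Matrix (Fin 3) (Fin 3) ℂ} (hM : M ∈ L) (hN : N ∈ L) : M * N - N * M ∈ L := by
    change positionSum d _ ∈ B
    rw [← positionSum_lie]
    exact sub_mem (mul_mem hM hN) (mul_mem hN hM)
  replace h1 : ∀ f, Matrix.diagonal f ∈ L := h1
  replace h2 : shiftMatrix ∈ L := h2
  replace h3 : shiftMatrix.transpose ∈ L := h3
  have hu (a : Fin 3) : Matrix.single a (a + 1) (1 : ℂ) ∈ L := by
    -- With S the shift and e_a the diagonal units, [e_a, S] = E_{a,a+1} - E_{a-1,a}. So [e_a, S] -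
    -- [e_{a+1}, S] has coefficient 2 at E_{a,a+1} and -1 at the two other units of S; adding S
    -- leaves 3 E_{a,a+1}.
    have := L.smul_mem (1 / 3) (add_mem h2 (sub_mem (hL (h1 (Pi.single a 1)) h2)
      (hL (h1 (Pi.single (a + 1) 1)) h2)))
    convert this using 1
    ext i j
    fin_cases a <;> fin_cases i <;> fin_cases j <;>
      simp [shiftMatrix, Matrix.mul_apply, Fin.sum_univ_three] <;> norm_num
  have hl (a : Fin 3) : Matrix.single (a + 1) a (1 : ℂ) ∈ L := by
    -- The transposed identity; transposition reverses the sign of a commutator.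
    have := L.smul_mem (-1 / 3) (sub_mem (sub_mem (hL (h1 (Pi.single a 1)) h3)
      (hL (h1 (Pi.single (a + 1) 1)) h3)) h3)
    convert this using 1
    ext i j
    fin_cases a <;> fin_cases i <;> fin_cases j <;>
      simp [shiftMatrix, Matrix.mul_apply, Fin.sum_univ_three] <;> norm_num
  have hs (a b : Fin 3) : Matrix.single a b (1 : ℂ) ∈ L := by
    have hab : ∀ a b : Fin 3, b = a ∨ b = a + 1 ∨ a = b + 1 := by decide
    obtain rfl | rfl | rfl := hab a b
    · rw [← Matrix.diagonal_single]; exact h1 _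
    · exact hu a
    · exact hl b
  change M ∈ L
  rw [Matrix.matrix_eq_sum_single M]
  refine sum_mem fun i _ => sum_mem fun j _ => ?_
  have := L.smul_mem (M i j) (hs i j)
  rwa [Matrix.smul_single, smul_eq_mul, mul_one] at this

/-! ### The Terwilliger algebra as the algebra of invariant matrices -/

/-- The identity map from `Fin 3` to `ZMod 3`. -/
def toZMod (a : Fin 3) : ZMod 3 := a

/-- Translation of words by the base vertex, as a map of matrix algebras. -/
noncomputable def translate {d : ℕ} (x : Fin d → ZMod 3) :
    Matrix (Fin d → ZMod 3) (Fin d → ZMod 3) ℂ ≃ₐ[ℂ]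
      Matrix (Fin d → Fin 3) (Fin d → Fin 3) ℂ :=
  Matrix.reindexAlgEquiv ℂ ℂ (Equiv.subRight x : (Fin d → ZMod 3) ≃ (Fin d → ZMod 3))

theorem translate_apply {d : ℕ} (x : Fin d → ZMod 3)
    (M : Matrix (Fin d → ZMod 3) (Fin d → ZMod 3) ℂ) (z w : Fin d → Fin 3) :
    translate x M z w = M (fun i => toZMod (z i) + x i) (fun i => toZMod (w i) + x i) := rfl

theorem toZMod_add_inj {d : ℕ} {x : Fin d → ZMod 3} {z w : Fin d → Fin 3} :
    (fun i => toZMod (z i) + x i) = (fun i => toZMod (w i) + x i) ↔ z = w := by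
  simp only [funext_iff, add_left_inj]
  rfl

theorem hammingDigraph_adj_toZMod {d : ℕ} {x : Fin d → ZMod 3} {z w : Fin d → Fin 3} :
    (hammingDigraph d).Adj (fun i => toZMod (z i) + x i) (fun i => toZMod (w i) + x i) ↔
      ∃ i, (∀ j, j ≠ i → z j = w j) ∧ z i + 1 = w i := by
  refine exists_congr fun i => ?_
  rw [and_comm]
  refine and_congr (forall_congr' fun j => imp_congr_right fun _ => add_left_inj (x j)) ?_
  have h : ∀ (a b : Fin 3) (c : ZMod 3), (toZMod a + c) + 1 = toZMod b + c ↔ a + 1 = b := by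
    decide
  exact h (z i) (w i) (x i)

theorem translate_adjMatrix {d : ℕ} (x : Fin d → ZMod 3) :
    translate x (adjMatrix (hammingDigraph d)) = positionSum d shiftMatrix := by
  ext z w
  rw [positionSum_apply, translate_apply, adjMatrix, Matrix.of_apply]
  simp only [hammingDigraph_adj_toZMod, shiftMatrix, Matrix.of_apply, ← ite_and]
  split_ifs with h
  · obtain ⟨i, h1, h2⟩ := h
    rw [Finset.sum_eq_single i, if_pos ⟨h1, h2⟩]
    · intro j _ hj
      rw [if_neg]
      rintro ⟨h3, h4⟩
      rw [h1 j hj] at h4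
      revert h4
      generalize w j = a
      revert a
      decide
    · simp
  · exact (Finset.sum_eq_zero fun i _ => if_neg fun hi => h ⟨i, hi⟩).symm

theorem translate_transpose {d : ℕ} (x : Fin d → ZMod 3)
    (M : Matrix (Fin d → ZMod 3) (Fin d → ZMod 3) ℂ) :
    translate x M.transpose = (translate x M).transpose := rfl

theorem positionSum_transpose {d : ℕ} (M : Matrix (Fin 3) (Fin 3) ℂ) :
    (positionSum d M).transpose = positionSum d M.transpose := by
  ext z w
  simp only [Matrix.transpose_apply, positionSum_apply, eq_comm]

/-- The pair of distances from and to the zero word. -/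
def wordWeight {d : ℕ} (z : Fin d → Fin 3) : ℕ × ℕ :=
  (∑ i, (z i : ℕ), ∑ i, ((-z i : Fin 3) : ℕ))

theorem twoWayDist_hammingDigraph {d : ℕ} (x : Fin d → ZMod 3) (z : Fin d → Fin 3) :
    twoWayDist (hammingDigraph d) x (fun i => toZMod (z i) + x i) = wordWeight z := by
  rw [twoWayDist, dist_hammingDigraph, dist_hammingDigraph]
  have h1 : ∀ (a : Fin 3) (b : ZMod 3), (toZMod a + b - b).val = (a : ℕ) := by decide
  have h2 : ∀ (a : Fin 3) (b : ZMod 3), (b - (toZMod a + b)).val = ((-a : Fin 3) : ℕ) := by decide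
  rw [wordWeight, Prod.mk.injEq]
  exact ⟨Finset.sum_congr rfl fun i _ => h1 (z i) (x i),
    Finset.sum_congr rfl fun i _ => h2 (z i) (x i)⟩

theorem translate_dualIdempotent {d : ℕ} (x : Fin d → ZMod 3) (p : ℕ × ℕ) :
    translate x (dualIdempotent (hammingDigraph d) x p) =
      Matrix.diagonal fun z => if wordWeight z = p then 1 else 0 := by
  ext z w
  rw [translate_apply, dualIdempotent, Matrix.diagonal_apply, Matrix.diagonal_apply,
    twoWayDist_hammingDigraph]
  exact if_congr toZMod_add_inj rfl rfl

theorem wordWeight_mem_twoWayDistSet {d : ℕ} (z : Fin d → Fin 3) :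
    wordWeight z ∈ twoWayDistSet (hammingDigraph d) :=
  ⟨0, _, twoWayDist_hammingDigraph 0 z⟩

theorem wordWeight_comp {d : ℕ} (σ : Equiv.Perm (Fin d)) (z : Fin d → Fin 3) :
    wordWeight (z ∘ σ) = wordWeight z :=
  Prod.ext (Equiv.sum_comp σ fun i => ((z i : Fin 3) : ℕ))
    (Equiv.sum_comp σ fun i => ((-z i : Fin 3) : ℕ))

theorem map_translate_terwilligerAlgebra {d : ℕ} (x : Fin d → ZMod 3) :
    (terwilligerAlgebra (hammingDigraph d) x).map (translate x).toAlgHom = symMatrixAlgebra d := by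
  rw [terwilligerAlgebra, AlgHom.map_adjoin]
  refine le_antisymm (Algebra.adjoin_le ?_) ?_
  · rintro _ ⟨M, (rfl | rfl) | ⟨p, -, rfl⟩, rfl⟩
    · change translate x _ ∈ symMatrixAlgebra d
      rw [translate_adjMatrix]
      exact positionSum_mem_symMatrixAlgebra _
    · change translate x _ ∈ symMatrixAlgebra d
      rw [translate_transpose, translate_adjMatrix, positionSum_transpose]
      exact positionSum_mem_symMatrixAlgebra _
    · change translate x _ ∈ symMatrixAlgebra d
      rw [translate_dualIdempotent]
      intro σ z w
      simp only [Matrix.diagonal_apply, wordWeight_comp, σ.surjective.injective_comp_right.eq_iff]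
  · set B := Algebra.adjoin ℂ ((translate x).toAlgHom '' ({adjMatrix (hammingDigraph d),
      (adjMatrix (hammingDigraph d)).transpose} ∪
        dualIdempotent (hammingDigraph d) x '' twoWayDistSet (hammingDigraph d)))
    have h2 : positionSum d shiftMatrix ∈ B :=
      Algebra.subset_adjoin ⟨_, Or.inl (Or.inl rfl), translate_adjMatrix x⟩
    have h3 : positionSum d shiftMatrix.transpose ∈ B := by
      refine Algebra.subset_adjoin ⟨_, Or.inl (Or.inr rfl), ?_⟩
      rw [← positionSum_transpose, ← translate_adjMatrix x]
      rfl
    -- Every diagonal matrix depending only on the two-way distance is a combination of dual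
    -- idempotents.
    have hE (F : ℕ × ℕ → ℂ) : Matrix.diagonal (fun z : Fin d → Fin 3 => F (wordWeight z)) ∈ B := by
      have hF : Matrix.diagonal (fun z : Fin d → Fin 3 => F (wordWeight z)) =
          ∑ p ∈ Finset.univ.image (wordWeight (d := d)),
            F p • Matrix.diagonal fun z => if wordWeight z = p then (1 : ℂ) else 0 := by
        ext z w
        rw [Matrix.sum_apply]
        obtain rfl | h := eq_or_ne z w
        · simp
        · simp [h]
      rw [hF]
      refine sum_mem fun p hp => B.smul_mem (Algebra.subset_adjoin ⟨_, Or.inr ⟨p, ?_, rfl⟩,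
        translate_dualIdempotent x p⟩) _
      obtain ⟨z, -, rfl⟩ := Finset.mem_image.1 hp
      exact wordWeight_mem_twoWayDistSet z
    refine symMatrixAlgebra_le (positionSum_mem_of_diagonal (fun f => ?_) h2 h3)
    rw [positionSum_diagonal]
    -- The functions 1, a and the residue of -a form a basis of the functions on the three letters.
    -- The coefficients α, β of the last two solve α + 2β = f 1 - f 0 and 2α + β = f 2 - f 0;
    -- summing over positions turns the basis into d, `p.1` and `p.2`.
    convert hE fun p => d * f 0 + (2 * (f 2 - f 0) - (f 1 - f 0)) / 3 * p.1 +
      (2 * (f 1 - f 0) - (f 2 - f 0)) / 3 * p.2 using 2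
    funext z
    have hf (a : Fin 3) : f a = f 0 + (2 * (f 2 - f 0) - (f 1 - f 0)) / 3 * (a : ℕ) +
        (2 * (f 1 - f 0) - (f 2 - f 0)) / 3 * ((-a : Fin 3) : ℕ) := by
      have h1 : ((-1 : Fin 3) : ℕ) = 2 := rfl
      have h2 : ((-2 : Fin 3) : ℕ) = 1 := rfl
      fin_cases a
      · simp
      · simp [h1]; ring
      · simp [h2]; ring
    rw [Finset.sum_congr rfl fun i _ => hf (z i), Finset.sum_add_distrib, Finset.sum_add_distrib,
      ← Finset.mul_sum, ← Finset.mul_sum, wordWeight]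
    simp

/-- The Terwilliger algebra is isomorphic to the algebra of permutation-invariant matrices. -/
noncomputable def terwilligerEquiv {d : ℕ} (x : Fin d → ZMod 3) :
    terwilligerAlgebra (hammingDigraph d) x ≃ₐ[ℂ] symMatrixAlgebra d :=
  ((translate x).subalgebraMap _).trans
    (Subalgebra.equivOfEq _ _ (map_translate_terwilligerAlgebra x))

/-! ### Tableaux, polytabloids and alternating functions -/

/-- An injective sequence of length `h ≤ 3` in `{0, 1, 2}` has sum at least `0 + ⋯ + (h - 1)`, and in
case of equality it is a permutation of `0, …, h - 1`. -/
theorem sum_le_sum_of_injective {h : ℕ} (hh : h ≤ 3) (w : Fin h → Fin 3)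
    (hw : Function.Injective w) :
    ∑ i : Fin h, (i : ℕ) ≤ ∑ i, (w i : ℕ) ∧ (∑ i, (w i : ℕ) ≤ ∑ i : Fin h, (i : ℕ) →
      ∃ π : Equiv.Perm (Fin h), ∀ i, w i = Fin.castLE hh (π i)) := by
  have key : ∑ i : Fin h, (i : ℕ) ≤ ∑ i, (w i : ℕ) ∧
      (∑ i, (w i : ℕ) ≤ ∑ i : Fin h, (i : ℕ) → ∀ i, (w i : ℕ) < h) := by
    interval_cases h <;> revert w <;> unfold Function.Injective <;> decide
  refine ⟨key.1, fun h1 => ?_⟩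
  have h2 := key.2 h1
  refine ⟨Equiv.ofBijective (fun i => ⟨w i, h2 i⟩) (Finite.injective_iff_bijective.1
    fun i j hij => hw (Fin.ext (Fin.mk.inj hij))), fun i => rfl⟩

/-- A filling of a diagram with columns of height at most `3` by the numbers in `Fin d`. -/
structure Tableau (d : ℕ) where
  /-- The type of columns. -/
  Col : Type
  [fintypeCol : Fintype Col]
  [decEqCol : DecidableEq Col]
  /-- The height of each column. -/
  height : Col → ℕ
  height_le : ∀ c, height c ≤ 3
  /-- The correspondence between positions and boxes. -/
  equiv : Fin d ≃ (c : Col) × Fin (height c)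

attribute [instance] Tableau.fintypeCol Tableau.decEqCol

namespace Tableau

variable {d : ℕ} (t : Tableau d)

/-- The position contained in a box. -/
def pos (c : t.Col) (i : Fin (t.height c)) : Fin d := t.equiv.symm ⟨c, i⟩

/-- The word that records the row index of each position. -/
def word : Fin d → Fin 3 := fun x => Fin.castLE (t.height_le _) (t.equiv x).2

theorem word_pos (c : t.Col) (i : Fin (t.height c)) :
    t.word (t.pos c i) = Fin.castLE (t.height_le c) i :=
  congrArg (fun b : (c : t.Col) × Fin (t.height c) => Fin.castLE (t.height_le b.1) b.2)
    (t.equiv.apply_symm_apply ⟨c, i⟩)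

theorem exists_pos (x : Fin d) : ∃ c i, t.pos c i = x :=
  ⟨(t.equiv x).1, (t.equiv x).2, t.equiv.symm_apply_apply x⟩

theorem sum_pos {M : Type*} [AddCommMonoid M] (f : Fin d → M) :
    ∑ x, f x = ∑ c, ∑ i, f (t.pos c i) := by
  rw [← Equiv.sum_comp t.equiv.symm, Fintype.sum_sigma]
  rfl

/-- The polytabloid: the product over the columns of the determinant functions. -/
noncomputable def vec (z : Fin d → Fin 3) : ℂ :=
  ∏ c, (Matrix.of fun i j : Fin (t.height c) =>
    if z (t.pos c i) = Fin.castLE (t.height_le c) j then (1 : ℂ) else 0).det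

/-- The permutation of positions induced by permutations of the boxes of each column. -/
def colPerm (π : ∀ c, Equiv.Perm (Fin (t.height c))) : Equiv.Perm (Fin d) :=
  (t.equiv.trans (Equiv.sigmaCongrRight π)).trans t.equiv.symm

theorem colPerm_pos (π : ∀ c, Equiv.Perm (Fin (t.height c))) (c : t.Col)
    (i : Fin (t.height c)) : t.colPerm π (t.pos c i) = t.pos c (π c i) := by
  simp [colPerm, pos]

/-- Functions on words that are alternating in the positions of each column. -/
def IsAlt (u : (Fin d → Fin 3) → ℂ) : Prop :=
  ∀ (π : ∀ c, Equiv.Perm (Fin (t.height c))) z,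
    u (z ∘ t.colPerm π) = (∏ c, ((Equiv.Perm.sign (π c) : ℤ) : ℂ)) * u z

variable {t}

theorem isAlt_vec : t.IsAlt t.vec := by
  intro π z
  rw [vec, vec, ← Finset.prod_mul_distrib]
  refine Finset.prod_congr rfl fun c _ => ?_
  rw [← Matrix.det_permute]
  simp only [Function.comp_apply, colPerm_pos]
  rfl

theorem vec_word : t.vec t.word = 1 := by
  refine Finset.prod_eq_one fun c _ => ?_
  refine (congrArg Matrix.det ?_).trans Matrix.det_one
  ext i j
  simp only [word_pos, Matrix.of_apply, Matrix.one_apply, (Fin.castLE_injective _).eq_iff]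

/-- Invariant matrices commute with permutations of positions, so alternation passes to everything
generated from the polytabloid. -/
theorem IsAlt.mulVec {u : (Fin d → Fin 3) → ℂ} (hu : t.IsAlt u)
    {M : Matrix (Fin d → Fin 3) (Fin d → Fin 3) ℂ} (hM : M ∈ symMatrixAlgebra d) :
    t.IsAlt (M.mulVec u) := by
  intro π z
  simp only [Matrix.mulVec, dotProduct]
  rw [← Equiv.sum_comp ((t.colPerm π).symm.arrowCongr (Equiv.refl (Fin 3))), Finset.mul_sum]
  refine Finset.sum_congr rfl fun w _ => ?_
  change M (z ∘ t.colPerm π) (w ∘ t.colPerm π) * u (w ∘ t.colPerm π) = _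
  rw [hM, hu]
  ring

theorem IsAlt.sub_smul {u v : (Fin d → Fin 3) → ℂ} (hu : t.IsAlt u) (hv : t.IsAlt v) (a : ℂ) :
    t.IsAlt (u - a • v) := by
  intro π z
  simp only [Pi.sub_apply, Pi.smul_apply, hu π z, hv π z, smul_eq_mul]
  ring

/-- Swapping two boxes of a column with equal letters fixes the word but changes the sign of `u`. -/
theorem IsAlt.injective {u : (Fin d → Fin 3) → ℂ} (hu : t.IsAlt u) {z : Fin d → Fin 3}
    (hz : u z ≠ 0) (c : t.Col) : Function.Injective fun i => z (t.pos c i) := by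
  intro i j hij
  by_contra hne
  set π : ∀ c, Equiv.Perm (Fin (t.height c)) := Function.update 1 c (Equiv.swap i j) with hπ
  have h1 : z ∘ t.colPerm π = z := by
    funext x
    obtain ⟨c', k, rfl⟩ := t.exists_pos x
    rw [Function.comp_apply, colPerm_pos]
    obtain rfl | hc := eq_or_ne c' c
    · rw [hπ, Function.update_self]
      obtain rfl | hi := eq_or_ne k i
      · rw [Equiv.swap_apply_left]; exact hij.symm
      · obtain rfl | hj := eq_or_ne k j
        · rw [Equiv.swap_apply_right]; exact hij
        · rw [Equiv.swap_apply_of_ne_of_ne hi hj]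
    · rw [hπ, Function.update_of_ne hc]; rfl
  have h2 : ∏ c', ((Equiv.Perm.sign (π c') : ℤ) : ℂ) = -1 := by
    rw [Finset.prod_eq_single c]
    · rw [hπ, Function.update_self, Equiv.Perm.sign_swap hne]; simp
    · intro c' _ hc; rw [hπ, Function.update_of_ne hc]; simp
    · simp
  have h3 := hu π z
  rw [h1, h2, neg_one_mul, eq_neg_iff_add_eq_zero, add_self_eq_zero] at h3
  exact hz h3

/-- The sum of the letters of a word. -/
def energy (z : Fin d → Fin 3) : ℕ := ∑ x, (z x : ℕ)

theorem energy_comp (z : Fin d → Fin 3) (σ : Equiv.Perm (Fin d)) : energy (z ∘ σ) = energy z :=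
  Equiv.sum_comp σ fun x => (z x : ℕ)

theorem energy_word : energy t.word = ∑ c, ∑ i : Fin (t.height c), (i : ℕ) := by
  rw [energy, t.sum_pos]
  simp only [word_pos, Fin.val_castLE]

theorem IsAlt.energy_le {u : (Fin d → Fin 3) → ℂ} (hu : t.IsAlt u) {z : Fin d → Fin 3}
    (hz : u z ≠ 0) : energy t.word ≤ energy z := by
  rw [energy_word, energy, t.sum_pos]
  exact Finset.sum_le_sum fun c _ =>
    (sum_le_sum_of_injective (t.height_le c) _ (hu.injective hz c)).1

theorem eq_word_comp {z : Fin d → Fin 3} {π : ∀ c, Equiv.Perm (Fin (t.height c))}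
    (h : ∀ c i, z (t.pos c i) = Fin.castLE (t.height_le c) (π c i)) :
    z = t.word ∘ t.colPerm π := by
  funext x
  obtain ⟨c, i, rfl⟩ := t.exists_pos x
  rw [Function.comp_apply, colPerm_pos, word_pos, h]

/-- Equality of the total energies forces equality in every column, where the letters are then a
permutation of the row indices. -/
theorem IsAlt.exists_colPerm {u : (Fin d → Fin 3) → ℂ} (hu : t.IsAlt u) {z : Fin d → Fin 3}
    (hz : u z ≠ 0) (he : energy z = energy t.word) : ∃ π, z = t.word ∘ t.colPerm π := by
  have h1 := fun c => sum_le_sum_of_injective (t.height_le c) _ (hu.injective hz c)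
  rw [energy_word, energy, t.sum_pos, eq_comm,
    Finset.sum_eq_sum_iff_of_le fun c _ => (h1 c).1] at he
  choose π hπ using fun c => (h1 c).2 (he c (Finset.mem_univ c)).ge
  exact ⟨π, eq_word_comp hπ⟩

theorem exists_colPerm_of_vec_ne_zero {z : Fin d → Fin 3} (hz : t.vec z ≠ 0) :
    ∃ π, z = t.word ∘ t.colPerm π := by
  have h1 (c) (i : Fin (t.height c)) : ∃ j, z (t.pos c i) = Fin.castLE (t.height_le c) j := by
    by_contra! h
    refine hz (Finset.prod_eq_zero (Finset.mem_univ c) (Matrix.det_eq_zero_of_row_eq_zero i ?_))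
    intro j
    rw [Matrix.of_apply, if_neg (h j)]
  choose f hf using h1
  have hinj (c) : Function.Injective (f c) := fun i j hij =>
    isAlt_vec.injective hz c (by simp only [hf, hij])
  exact ⟨fun c => Equiv.ofBijective (f c) (Finite.injective_iff_bijective.1 (hinj c)),
    eq_word_comp hf⟩

theorem IsAlt.eq_zero_of_word {u : (Fin d → Fin 3) → ℂ} (hu : t.IsAlt u) (h0 : u t.word = 0)
    (σ : Equiv.Perm (Fin d)) : u (t.word ∘ σ) = 0 := by
  by_contra hz
  obtain ⟨π, hπ⟩ := hu.exists_colPerm hz (energy_comp _ _)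
  rw [hπ, hu, h0, mul_zero] at hz
  exact hz rfl

variable (t)

open Classical in
/-- The projection onto the words with the same letters as `t.word`. -/
noncomputable def weightProj : Matrix (Fin d → Fin 3) (Fin d → Fin 3) ℂ :=
  Matrix.diagonal fun z => if ∃ σ : Equiv.Perm (Fin d), z = t.word ∘ σ then 1 else 0

theorem weightProj_mem : t.weightProj ∈ symMatrixAlgebra d := by
  intro σ z w
  have h : (∃ τ : Equiv.Perm (Fin d), z ∘ σ = t.word ∘ τ) ↔
      ∃ τ : Equiv.Perm (Fin d), z = t.word ∘ τ := by
    constructor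
    · rintro ⟨τ, hτ⟩
      refine ⟨τ * σ⁻¹, funext fun x => ?_⟩
      have := congrFun hτ (σ⁻¹ x)
      simpa using this
    · rintro ⟨τ, rfl⟩
      exact ⟨τ * σ, rfl⟩
  simp only [weightProj, Matrix.diagonal_apply, h, σ.surjective.injective_comp_right.eq_iff]

theorem weightProj_mulVec_apply (u : (Fin d → Fin 3) → ℂ) (z : Fin d → Fin 3)
    [Decidable (∃ σ : Equiv.Perm (Fin d), z = t.word ∘ σ)] :
    t.weightProj.mulVec u z = if ∃ σ : Equiv.Perm (Fin d), z = t.word ∘ σ then u z else 0 := by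
  rw [weightProj, Matrix.mulVec_diagonal, ite_mul, one_mul, zero_mul]
  congr

variable {t}

/-- The rank-one property. The function `u - u t.word • t.vec` alternates and vanishes at `t.word`,
hence on all rearrangements of it, by minimality of their energy; elsewhere `t.vec` is zero. -/
theorem IsAlt.weightProj_mulVec {u : (Fin d → Fin 3) → ℂ} (hu : t.IsAlt u) :
    t.weightProj.mulVec u = u t.word • t.vec := by
  classical
  funext z
  rw [weightProj_mulVec_apply, Pi.smul_apply, smul_eq_mul]
  split_ifs with h
  · obtain ⟨σ, rfl⟩ := h
    have := (hu.sub_smul isAlt_vec (u t.word)).eq_zero_of_word (by simp [vec_word]) σ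
    simpa [sub_eq_zero] using this
  · by_contra hz
    obtain ⟨π, hπ⟩ := exists_colPerm_of_vec_ne_zero (right_ne_zero_of_mul (Ne.symm hz))
    exact h ⟨_, hπ⟩

/-- A word in the support of `u` with the content of `t.word` would have the minimal energy for
`t'`, hence be a rearrangement of `t'.word`. -/
theorem IsAlt.weightProj_mulVec_eq_zero {t' : Tableau d} {u : (Fin d → Fin 3) → ℂ}
    (hu : t'.IsAlt u) (h1 : energy t.word ≤ energy t'.word)
    (h2 : ∀ σ : Equiv.Perm (Fin d), t.word ≠ t'.word ∘ σ) : t.weightProj.mulVec u = 0 := by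
  classical
  funext z
  rw [weightProj_mulVec_apply]
  split_ifs with h
  · obtain ⟨σ, rfl⟩ := h
    by_contra hz
    obtain ⟨π, hπ⟩ := hu.exists_colPerm hz
      (le_antisymm ((energy_comp _ _).trans_le h1) (hu.energy_le hz))
    refine h2 (t'.colPerm π * σ⁻¹) (funext fun x => ?_)
    have := congrFun hπ (σ⁻¹ x)
    simpa using this
  · rfl

end Tableau

/-! ### Weyl modules and joint surjectivity of their representations -/

theorem conjTranspose_mem_symMatrixAlgebra {d : ℕ}
    {M : Matrix (Fin d → Fin 3) (Fin d → Fin 3) ℂ} (hM : M ∈ symMatrixAlgebra d) :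
    M.conjTranspose ∈ symMatrixAlgebra d := fun σ z w => by
  rw [Matrix.conjTranspose_apply, Matrix.conjTranspose_apply, hM]

namespace Tableau

variable {d : ℕ} (t : Tableau d)

/-- The Weyl module: the cyclic submodule generated by the polytabloid. -/
noncomputable def weyl : Submodule ℂ ((Fin d → Fin 3) → ℂ) where
  carrier := {u | ∃ M ∈ symMatrixAlgebra d, M.mulVec t.vec = u}
  zero_mem' := ⟨0, zero_mem _, Matrix.zero_mulVec _⟩
  add_mem' := by
    rintro _ _ ⟨M, hM, rfl⟩ ⟨N, hN, rfl⟩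
    exact ⟨M + N, add_mem hM hN, Matrix.add_mulVec _ _ _⟩
  smul_mem' := by
    rintro c _ ⟨M, hM, rfl⟩
    exact ⟨c • M, Subalgebra.smul_mem _ hM c, Matrix.smul_mulVec _ _ _⟩

variable {t}

theorem mulVec_mem_weyl {M : Matrix (Fin d → Fin 3) (Fin d → Fin 3) ℂ}
    (hM : M ∈ symMatrixAlgebra d) {u : (Fin d → Fin 3) → ℂ} (hu : u ∈ t.weyl) :
    M.mulVec u ∈ t.weyl := by
  obtain ⟨N, hN, rfl⟩ := hu
  exact ⟨M * N, mul_mem hM hN, (Matrix.mulVec_mulVec _ _ _).symm⟩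

theorem isAlt_of_mem_weyl {u : (Fin d → Fin 3) → ℂ} (hu : u ∈ t.weyl) : t.IsAlt u := by
  obtain ⟨M, hM, rfl⟩ := hu
  exact isAlt_vec.mulVec hM

theorem vec_mem_weyl : t.vec ∈ t.weyl := ⟨1, one_mem _, Matrix.one_mulVec _⟩

variable (t)

/-- The representation of the algebra of permutation-invariant matrices on the Weyl module. -/
noncomputable def weylRep : symMatrixAlgebra d →ₐ[ℂ] Module.End ℂ t.weyl where
  toFun M := M.1.mulVecLin.restrict fun _ hu => mulVec_mem_weyl M.2 hu
  map_one' := LinearMap.ext fun u => Subtype.ext (Matrix.one_mulVec _)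
  map_mul' M N := LinearMap.ext fun u => Subtype.ext (Matrix.mulVec_mulVec _ _ _).symm
  map_zero' := LinearMap.ext fun u => Subtype.ext (Matrix.zero_mulVec _)
  map_add' M N := LinearMap.ext fun u => Subtype.ext (Matrix.add_mulVec _ _ _)
  commutes' c := LinearMap.ext fun u => Subtype.ext (by
    change (algebraMap ℂ (Matrix (Fin d → Fin 3) (Fin d → Fin 3) ℂ) c).mulVec u.1 = c • u.1
    rw [Algebra.algebraMap_eq_smul_one, Matrix.smul_mulVec, Matrix.one_mulVec])

variable {t}

theorem weylRep_apply (M : symMatrixAlgebra d) (u : t.weyl) :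
    (t.weylRep M u : (Fin d → Fin 3) → ℂ) = M.1.mulVec u.1 := rfl

/-- The projection `weightProj` as an element of the algebra. -/
noncomputable def weightIdem (t : Tableau d) : symMatrixAlgebra d := ⟨t.weightProj, t.weightProj_mem⟩

theorem weylRep_weightIdem_apply (u : t.weyl) :
    t.weylRep t.weightIdem u = u.1 t.word • ⟨t.vec, vec_mem_weyl⟩ :=
  Subtype.ext (isAlt_of_mem_weyl u.2).weightProj_mulVec

theorem weylRep_weightIdem_eq_zero {t' : Tableau d} (h1 : energy t.word ≤ energy t'.word)
    (h2 : ∀ σ : Equiv.Perm (Fin d), t.word ≠ t'.word ∘ σ) : t'.weylRep t.weightIdem = 0 :=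
  LinearMap.ext fun u => Subtype.ext ((isAlt_of_mem_weyl u.2).weightProj_mulVec_eq_zero h1 h2)

-- Write u = N v with v the polytabloid, and let P be the weight projection. The hypothesis for N*
-- gives P N* N v = 0. As P is self-adjoint and P v = v, the squared norm of N v is ⟨v, N* N v⟩ =
-- ⟨v, P N* N v⟩ = 0.
open scoped ComplexOrder in
theorem eq_zero_of_forall_mulVec_word {u : (Fin d → Fin 3) → ℂ} (hu : u ∈ t.weyl)
    (h : ∀ M ∈ symMatrixAlgebra d, M.mulVec u t.word = 0) : u = 0 := by
  obtain ⟨N, hN, rfl⟩ := id hu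
  have h1 := h _ (conjTranspose_mem_symMatrixAlgebra hN)
  set v := N.conjTranspose.mulVec (N.mulVec t.vec) with hv
  have h2 : t.IsAlt v := (isAlt_of_mem_weyl hu).mulVec (conjTranspose_mem_symMatrixAlgebra hN)
  have h3 : t.weightProj.mulVec v = 0 := by rw [h2.weightProj_mulVec, h1, zero_smul]
  have h4 : t.weightProj.mulVec t.vec = t.vec := by
    rw [isAlt_vec.weightProj_mulVec, vec_word, one_smul]
  have h5 : t.weightProj.conjTranspose = t.weightProj := by
    rw [weightProj, Matrix.diagonal_conjTranspose]
    congr 1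
    funext z
    simp only [Pi.star_apply, apply_ite star, star_one, star_zero]
  have h6 : star t.vec ⬝ᵥ v = 0 := by
    rw [← h4, Matrix.star_mulVec, ← Matrix.dotProduct_mulVec, h5, h3, dotProduct_zero]
  rw [hv, Matrix.dotProduct_mulVec, ← Matrix.star_mulVec] at h6
  exact dotProduct_star_self_eq_zero.1 h6

/-- The functional `u ↦ (M u) t.word` on the Weyl module. -/
noncomputable def wordFunctional (t : Tableau d) : symMatrixAlgebra d →ₗ[ℂ] Module.Dual ℂ t.weyl where
  toFun M := (LinearMap.proj t.word).comp (t.weyl.subtype.comp (t.weylRep M))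
  map_add' M N := by
    ext u
    simp
  map_smul' c M := by
    ext u
    simp

theorem wordFunctional_apply (M : symMatrixAlgebra d) (u : t.weyl) :
    t.wordFunctional M u = (t.weylRep M u).1 t.word := rfl

/-- The functionals have no common zero but 0, so in finite dimension they exhaust the dual. -/
theorem wordFunctional_surjective : Function.Surjective t.wordFunctional := by
  rw [← LinearMap.range_eq_top]
  rw [← Subspace.dualCoannihilator_dualAnnihilator_eq (W := LinearMap.range t.wordFunctional)]
  have h : (LinearMap.range t.wordFunctional).dualCoannihilator = ⊥ := by
    rw [eq_bot_iff]
    intro u hu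
    rw [Submodule.mem_dualCoannihilator] at hu
    exact Subtype.ext (eq_zero_of_forall_mulVec_word u.2 fun M hM => hu _ ⟨⟨M, hM⟩, rfl⟩)
  rw [h, Submodule.dualAnnihilator_bot]

/-- Every endomorphism of the Weyl module is realized by an element of the two-sided ideal generated
by the weight idempotent. -/
theorem exists_weylRep_eq (F : Module.End ℂ t.weyl) : ∃ M, t.weylRep M = F ∧
    ∀ t' : Tableau d, t'.weylRep t.weightIdem = 0 → t'.weylRep M = 0 := by
  let b := Module.finBasis ℂ t.weyl
  choose B hB using fun i => t.wordFunctional_surjective (b.coord i)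
  choose A hA using fun i => (F (b i)).2
  -- The i-th summand acts as u ↦ (i-th coordinate of u) • F (b i): `B i` followed by the idempotent
  -- yields that coordinate times the polytabloid, which `A i` sends to `F (b i)`. The idempotent in
  -- each summand gives the second claim.
  refine ⟨∑ i, ⟨A i, (hA i).1⟩ * t.weightIdem * B i, b.ext fun j => ?_, fun t' h => ?_⟩
  · rw [map_sum, LinearMap.sum_apply, Finset.sum_eq_single j]
    · rw [map_mul, map_mul, Module.End.mul_apply, Module.End.mul_apply, weylRep_weightIdem_apply,
        ← wordFunctional_apply, hB, map_smul]
      refine Subtype.ext ?_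
      simp [weylRep_apply, hA]
    · intro i _ hi
      rw [map_mul, map_mul, Module.End.mul_apply, Module.End.mul_apply, weylRep_weightIdem_apply,
        ← wordFunctional_apply, hB]
      simp [hi.symm]
    · simp
  · simp [map_sum, map_mul, h]

/-- Weyl modules of tableaux with pairwise different content are jointly surjective. -/
theorem pi_weylRep_surjective {I : Type*} [Fintype I] [DecidableEq I] (t : I → Tableau d)
    (ht : ∀ p q, ∀ σ : Equiv.Perm (Fin d), (t p).word = (t q).word ∘ σ → p = q) :
    Function.Surjective (AlgHom.pi fun p => (t p).weylRep) := by
  set Φ := AlgHom.pi fun p => (t p).weylRep with hΦ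
  have key : ∀ n p, energy (t p).word = n → ∀ F : Module.End ℂ (t p).weyl,
      Pi.single p F ∈ Φ.range := by
    intro n
    induction n using Nat.strong_induction_on with
    | _ n ih =>
      intro p hp F
      obtain ⟨M, hM, hM'⟩ := exists_weylRep_eq F
      -- The image of `M` is `F` at `p` and zero at every other `q` of energy at least `n`; the
      -- components of lower energy are in the range by induction and are subtracted.
      have h : Pi.single p F = Φ M + (-1 : ℂ) • ∑ q, if energy (t q).word < n then
          Pi.single q ((t q).weylRep M) else 0 := by
        funext q
        have h1 : (∑ r, if energy (t r).word < n then
            (Pi.single r ((t r).weylRep M) : ∀ r, Module.End ℂ (t r).weyl) else 0) q =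
            if energy (t q).word < n then (t q).weylRep M else 0 := by
          rw [Finset.sum_apply, Finset.sum_eq_single q]
          · split_ifs <;> simp
          · intro r _ hr
            split_ifs
            · exact Pi.single_eq_of_ne hr.symm _
            · rfl
          · simp
        rw [Pi.add_apply, Pi.smul_apply, h1]
        change _ = (t q).weylRep M + _
        obtain rfl | hq := eq_or_ne q p
        · rw [if_neg (by omega), Pi.single_eq_same, hM, smul_zero, add_zero]
        · rw [Pi.single_eq_of_ne hq]
          split_ifs with h2
          · refine LinearMap.ext fun u => ?_
            rw [LinearMap.add_apply, LinearMap.smul_apply, neg_one_smul, add_neg_cancel,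
              LinearMap.zero_apply]
          · rw [hM' _ (weylRep_weightIdem_eq_zero (by omega) fun σ hσ => hq (ht p q σ hσ).symm),
              smul_zero, add_zero]
      rw [h]
      refine add_mem (Φ.mem_range_self M) (Subalgebra.smul_mem _ (sum_mem fun q _ => ?_) _)
      split_ifs with h2
      · exact ih _ h2 q rfl _
      · exact zero_mem _
  intro F
  change F ∈ Φ.range
  rw [← Finset.univ_sum_single F]
  exact sum_mem fun p _ => key _ p rfl _

end Tableau

/-! ### Lower bound for the dimension of a Weyl module -/

theorem linearIndependent_of_natDegree_injective {ι : Type*} {p : ι → Polynomial ℂ}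
    (h0 : ∀ i, p i ≠ 0) (hinj : Function.Injective fun i => (p i).natDegree) :
    LinearIndependent ℂ p := by
  rw [linearIndependent_iff']
  intro s g hg
  by_contra! hne
  obtain ⟨i, hi, hgi⟩ := hne
  have hdeg (j) (hj : g j ≠ 0) : (g j • p j).degree = (p j).natDegree := by
    rw [Polynomial.degree_smul_of_isRightRegular_leadingCoeff hj
      (IsRegular.of_ne_zero (by simpa using h0 j)).right, Polynomial.degree_eq_natDegree (h0 j)]
  have hsum := Polynomial.degree_sum_eq_of_disjoint (fun j => g j • p j) s (by
    intro x hx y hy hxy hd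
    change (g x • p x).degree = (g y • p y).degree at hd
    rw [hdeg x (smul_ne_zero_iff.1 hx.2).1, hdeg y (smul_ne_zero_iff.1 hy.2).1, Nat.cast_inj] at hd
    exact hxy (hinj hd))
  rw [hg, Polynomial.degree_zero] at hsum
  have h1 : (g i • p i).degree ≤ ⊥ := hsum ▸ Finset.le_sup (f := fun j => (g j • p j).degree) hi
  rw [hdeg i hgi] at h1
  simp at h1

theorem kron_const_mem_symMatrixAlgebra {d : ℕ} (g : Matrix (Fin 3) (Fin 3) ℂ) :
    kron (fun _ : Fin d => g) ∈ symMatrixAlgebra d := fun σ z w =>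
  Equiv.prod_comp σ fun i => g (z i) (w i)

/-- A tensor power of `g` turns the determinant function of a column into a minor of `g` on its
first `h` columns: expand the determinant and sum over each letter separately. -/
theorem sum_prod_mul_det {h : ℕ} (hh : h ≤ 3) (g : Matrix (Fin 3) (Fin 3) ℂ) (z : Fin h → Fin 3) :
    ∑ w : Fin h → Fin 3, (∏ i, g (z i) (w i)) * (Matrix.of fun i j : Fin h =>
      if w i = Fin.castLE hh j then (1 : ℂ) else 0).det =
    (Matrix.of fun i j : Fin h => g (z i) (Fin.castLE hh j)).det := by
  simp only [Matrix.det_apply', Finset.mul_sum, Matrix.of_apply]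
  rw [Finset.sum_comm]
  refine Finset.sum_congr rfl fun σ _ => ?_
  have h1 (i : Fin h) : g (z (σ i)) (Fin.castLE hh i) =
      ∑ a, g (z (σ i)) a * if a = Fin.castLE hh i then (1 : ℂ) else 0 := by
    simp
  simp only [h1, Finset.prod_univ_sum, Fintype.piFinset_univ, Finset.mul_sum]
  rw [← Equiv.sum_comp (σ.arrowCongr (Equiv.refl (Fin 3)))]
  refine Finset.sum_congr rfl fun w _ => ?_
  have h2 : ∏ i, g (z i) (w (σ.symm i)) = ∏ i, g (z (σ i)) (w i) := by
    rw [← Equiv.prod_comp σ]; simp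
  have h3 (i : Fin h) : (σ.arrowCongr (Equiv.refl (Fin 3))) w i = w (σ.symm i) := rfl
  simp only [h3, h2, Equiv.symm_apply_apply, Finset.prod_mul_distrib]
  rw [mul_left_comm]

namespace Tableau

variable {d : ℕ} (t : Tableau d)

theorem prod_pos {M : Type*} [CommMonoid M] (f : Fin d → M) :
    ∏ x, f x = ∏ c, ∏ i, f (t.pos c i) := by
  rw [← Equiv.prod_comp t.equiv.symm, Fintype.prod_sigma]
  rfl

/-- Words are families of columns. -/
def wordEquiv : (Fin d → Fin 3) ≃ (∀ c, Fin (t.height c) → Fin 3) :=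
  (t.equiv.arrowCongr (Equiv.refl (Fin 3))).trans (Equiv.piCurry fun _ _ => Fin 3)

theorem kron_const_mulVec_vec (g : Matrix (Fin 3) (Fin 3) ℂ) (z : Fin d → Fin 3) :
    (kron fun _ => g).mulVec t.vec z = ∏ c, (Matrix.of fun i j : Fin (t.height c) =>
      g (z (t.pos c i)) (Fin.castLE (t.height_le c) j)).det := by
  simp only [← sum_prod_mul_det, Finset.prod_univ_sum, Fintype.piFinset_univ]
  rw [← Equiv.sum_comp t.wordEquiv]
  refine Finset.sum_congr rfl fun w _ => ?_
  change kron (fun _ => g) z w * t.vec w = _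
  rw [kron_apply, t.prod_pos, vec, ← Finset.prod_mul_distrib]
  rfl

/-- Words and polynomials such that the coordinates of the translates of the polytabloid along a
curve are given by linearly independent polynomials bound the dimension of the Weyl module. -/
theorem card_le_finrank_weyl {ι : Type*} [Fintype ι] (z : ι → Fin d → Fin 3)
    (g : ℂ → Matrix (Fin 3) (Fin 3) ℂ) (p : ι → Polynomial ℂ) (hp : LinearIndependent ℂ p)
    (h : ∀ r i, (kron fun _ => g r).mulVec t.vec (z i) = (p i).eval r) :
    Fintype.card ι ≤ Module.finrank ℂ t.weyl := by
  -- Coordinate functionals evaluated along the curve r ↦ (g r)^{⊗d} v become the polynomials `p i`,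
  -- so their independence gives that of the functionals.
  let ξ : ι → Module.Dual ℂ t.weyl := fun i => (LinearMap.proj (z i)).comp t.weyl.subtype
  let ev : Module.Dual ℂ t.weyl →ₗ[ℂ] (ℂ → ℂ) := LinearMap.pi fun r =>
    Module.Dual.eval ℂ t.weyl ⟨_, _, kron_const_mem_symMatrixAlgebra (g r), rfl⟩
  let pe : Polynomial ℂ →ₗ[ℂ] (ℂ → ℂ) := LinearMap.pi fun r => Polynomial.leval r
  have hpe : LinearMap.ker pe = ⊥ := LinearMap.ker_eq_bot.2 fun a b hab =>
    Polynomial.funext fun r => congrFun hab r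
  have h1 : LinearIndependent ℂ (ev ∘ ξ) := by
    have h0 : ev ∘ ξ = pe ∘ p := funext fun i => funext fun r => h r i
    rw [h0]
    exact hp.map' pe hpe
  have h2 := (LinearIndependent.of_comp ev h1).fintype_card_le_finrank
  rwa [Subspace.dual_finrank_eq] at h2

end Tableau

theorem prod_ite_lt {n a b : ℕ} (hab : a + b ≤ n) (x y : ℂ) :
    ∏ i : Fin n, (if (i : ℕ) < a then x else if (i : ℕ) < a + b then y else 1) =
      x ^ a * y ^ b := by
  obtain ⟨c, rfl⟩ := Nat.exists_eq_add_of_le hab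
  rw [Fin.prod_univ_eq_prod_range (fun i => if i < a then x else if i < a + b then y else 1),
    Finset.prod_range_add, Finset.prod_range_add]
  have h1 : ∏ i ∈ Finset.range a, (if i < a then x else if i < a + b then y else 1) = x ^ a := by
    rw [Finset.prod_congr rfl fun i hi => if_pos (Finset.mem_range.1 hi)]
    simp
  have h2 : ∏ i ∈ Finset.range b, (if a + i < a then x else if a + i < a + b then y else 1) =
      y ^ b := by
    rw [Finset.prod_congr rfl (g := fun _ => y) fun i hi => ?_]
    · simp
    · rw [if_neg (by omega), if_pos (by have := Finset.mem_range.1 hi; omega)]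
  have h3 : ∏ i ∈ Finset.range c,
      (if a + b + i < a then x else if a + b + i < a + b then y else 1) = 1 :=
    Finset.prod_eq_one fun i _ => by rw [if_neg (by omega), if_neg (by omega)]
  rw [h1, h2, h3, mul_one]

/-- The diagram with `l` columns of height `3`, `m` columns of height `2` and `k` columns of height
`1`. -/
noncomputable def columnTableau (d l m k : ℕ) (h : 3 * l + 2 * m + k = d) : Tableau d where
  Col := Fin l ⊕ Fin m ⊕ Fin k
  height := Sum.elim (fun _ => 3) (Sum.elim (fun _ => 2) fun _ => 1)
  height_le c := by rcases c with c | c | c <;> simp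
  equiv := Fintype.equivOfCardEq (by
    simp only [Fintype.card_fin, Fintype.card_sigma, Fintype.sum_sum_type, Sum.elim_inl,
      Sum.elim_inr, Finset.sum_const, Finset.card_univ, smul_eq_mul]
    omega)

/-- A family of columns for `columnTableau`, with prescribed numbers of columns of each kind. -/
def columnWord (l m k a b c e : ℕ) : (q : Fin l ⊕ Fin m ⊕ Fin k) →
    Fin (Sum.elim (fun _ => 3) (Sum.elim (fun _ => 2) fun _ => 1) q) → Fin 3
  | .inl _ => id
  | .inr (.inl q) => if (q : ℕ) < c then ![0, 2] else if (q : ℕ) < c + e then ![1, 2] else ![0, 1]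
  | .inr (.inr q) => if (q : ℕ) < a then ![1] else if (q : ℕ) < a + b then ![2] else ![0]

/-- A unipotent lower triangular matrix. -/
def lowerUnipotent (x y s : ℂ) : Matrix (Fin 3) (Fin 3) ℂ := !![1, 0, 0; x, 1, 0; s, y, 1]

/-- In the first two columns, the minors on rows {0,2}, {1,2}, {0,1} are y, xy - s, 1; the entries
of the first column in rows 1, 2, 0 are x, s, 1. -/
theorem lowerUnipotent_mulVec_vec {d l m k : ℕ} (h : 3 * l + 2 * m + k = d) {a b c e : ℕ}
    (hab : a + b ≤ k) (hce : c + e ≤ m) (x y s : ℂ) :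
    (kron fun _ => lowerUnipotent x y s).mulVec (columnTableau d l m k h).vec (fun i =>
      columnWord l m k a b c e ((columnTableau d l m k h).equiv i).1
        ((columnTableau d l m k h).equiv i).2) =
    y ^ c * (x * y - s) ^ e * (x ^ a * s ^ b) := by
  set t := columnTableau d l m k h
  have hpos (q : Fin l ⊕ Fin m ⊕ Fin k)
      (i : Fin (Sum.elim (fun _ => 3) (Sum.elim (fun _ => 2) fun _ => 1) q)) :
      columnWord l m k a b c e (t.equiv (t.pos q i)).1 (t.equiv (t.pos q i)).2 =
        columnWord l m k a b c e q i :=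
    congrArg (fun b' : (q : t.Col) × Fin (t.height q) => columnWord l m k a b c e b'.1 b'.2)
      (t.equiv.apply_symm_apply ⟨q, i⟩)
  rw [Tableau.kron_const_mulVec_vec]
  have det3 (hh : 3 ≤ 3) : (Matrix.of fun i j : Fin 3 => lowerUnipotent x y s (id i)
      (Fin.castLE hh j)).det = 1 := by
    rw [Matrix.det_fin_three]
    simp [lowerUnipotent]
  have det2 (hh : 2 ≤ 3) (f : Fin 2 → Fin 3) : (Matrix.of fun i j : Fin 2 =>
      lowerUnipotent x y s (f i) (Fin.castLE hh j)).det =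
        lowerUnipotent x y s (f 0) 0 * lowerUnipotent x y s (f 1) 1 -
          lowerUnipotent x y s (f 0) 1 * lowerUnipotent x y s (f 1) 0 := by
    rw [Matrix.det_fin_two]
    rfl
  have det1 (hh : 1 ≤ 3) (f : Fin 1 → Fin 3) : (Matrix.of fun i j : Fin 1 =>
      lowerUnipotent x y s (f i) (Fin.castLE hh j)).det = lowerUnipotent x y s (f 0) 0 := by
    rw [Matrix.det_fin_one]
    rfl
  have hdet : ∀ q : Fin l ⊕ Fin m ⊕ Fin k,
      (Matrix.of fun i j : Fin (t.height q) => lowerUnipotent x y s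
        (columnWord l m k a b c e (t.equiv (t.pos q i)).1 (t.equiv (t.pos q i)).2)
          (Fin.castLE (t.height_le q) j)).det =
      Sum.elim (fun _ => 1) (Sum.elim
        (fun q : Fin m => if (q : ℕ) < c then y else if (q : ℕ) < c + e then x * y - s else 1)
        (fun q : Fin k => if (q : ℕ) < a then x else if (q : ℕ) < a + b then s else 1)) q := by
    intro q
    refine (congrArg (fun f => (Matrix.of fun i j : Fin (t.height q) => lowerUnipotent x y s
      (f i) (Fin.castLE (t.height_le q) j)).det) (funext fun i => hpos q i)).trans ?_
    rcases q with q | q | q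
    · exact det3 _
    · refine (det2 _ (columnWord l m k a b c e (.inr (.inl q)))).trans ?_
      simp only [columnWord, Sum.elim_inr, Sum.elim_inl]
      split_ifs <;> simp [lowerUnipotent]
    · refine (det1 _ (columnWord l m k a b c e (.inr (.inr q)))).trans ?_
      simp only [columnWord, Sum.elim_inr]
      split_ifs <;> simp [lowerUnipotent]
  refine (Finset.prod_congr rfl fun q _ => hdet q).trans ?_
  refine (Fintype.prod_sum_type _).trans ?_
  rw [Fintype.prod_sum_type]
  simp only [Sum.elim_inl, Sum.elim_inr, Finset.prod_const_one, one_mul, prod_ite_lt hab,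
    prod_ite_lt hce]

/-- The polynomials used to bound the dimension of the Weyl module. -/
noncomputable def columnPoly (N a b c e : ℕ) : Polynomial ℂ :=
  (Polynomial.X ^ N) ^ c * (Polynomial.X * Polynomial.X ^ N - Polynomial.X ^ (N ^ 2)) ^ e *
    (Polynomial.X ^ a * (Polynomial.X ^ (N ^ 2)) ^ b)

theorem natDegree_sub_pow {N : ℕ} (hN : 2 ≤ N) :
    (Polynomial.X * Polynomial.X ^ N - Polynomial.X ^ (N ^ 2) : Polynomial ℂ).natDegree =
      N ^ 2 := by
  rw [← pow_succ', Polynomial.natDegree_sub_eq_right_of_natDegree_lt, Polynomial.natDegree_X_pow]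
  rw [Polynomial.natDegree_X_pow, Polynomial.natDegree_X_pow]
  nlinarith

theorem columnPoly_ne_zero {N : ℕ} (hN : 2 ≤ N) (a b c e : ℕ) : columnPoly N a b c e ≠ 0 := by
  have h : (Polynomial.X * Polynomial.X ^ N - Polynomial.X ^ (N ^ 2) : Polynomial ℂ) ≠ 0 := by
    intro h
    have h2 := natDegree_sub_pow hN
    rw [h, Polynomial.natDegree_zero] at h2
    nlinarith
  have hX : (Polynomial.X : Polynomial ℂ) ≠ 0 := Polynomial.X_ne_zero
  exact mul_ne_zero (mul_ne_zero (pow_ne_zero _ (pow_ne_zero _ hX)) (pow_ne_zero _ h))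
    (mul_ne_zero (pow_ne_zero _ hX) (pow_ne_zero _ (pow_ne_zero _ hX)))

/-- Substituting x = X, y = X^N, s = X^(N²) makes s dominate xy. The degree then encodes `a`, `c`
and `b + e` as digits in base `N`. -/
theorem natDegree_columnPoly {N : ℕ} (hN : 2 ≤ N) (a b c e : ℕ) :
    (columnPoly N a b c e).natDegree = a + N * (c + N * (b + e)) := by
  have h0 := columnPoly_ne_zero hN a b c e
  rw [columnPoly] at h0 ⊢
  have h1 := left_ne_zero_of_mul h0
  have h2 := right_ne_zero_of_mul h0
  rw [Polynomial.natDegree_mul h1 h2,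
    Polynomial.natDegree_mul (left_ne_zero_of_mul h1) (right_ne_zero_of_mul h1),
    Polynomial.natDegree_mul (left_ne_zero_of_mul h2) (right_ne_zero_of_mul h2),
    Polynomial.natDegree_pow, Polynomial.natDegree_pow, Polynomial.natDegree_pow,
    Polynomial.natDegree_pow, natDegree_sub_pow hN, Polynomial.natDegree_pow,
    Polynomial.natDegree_pow, Polynomial.natDegree_X]
  ring

theorem two_mul_card_sigma (k m : ℕ) :
    2 * Fintype.card ((a : Fin (k + 1)) × (c : Fin (m + 1)) × Fin (a + c + 1)) =
      (k + 1) * (m + 1) * (k + m + 2) := by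
  have h1 (a n : ℕ) : 2 * ∑ c ∈ Finset.range n, (a + c + 1) = n * (2 * a + n + 1) := by
    induction n with
    | zero => simp
    | succ n ih => rw [Finset.sum_range_succ, mul_add, ih]; ring
  have h2 (n : ℕ) : ∑ a ∈ Finset.range n, (m + 1) * (2 * a + (m + 1) + 1) =
      n * (m + 1) * (n + m + 1) := by
    induction n with
    | zero => simp
    | succ n ih => rw [Finset.sum_range_succ, ih]; ring
  simp only [Fintype.card_sigma, Fintype.card_fin]
  have hc (a : ℕ) : ∑ c : Fin (m + 1), (a + c + 1) = ∑ c ∈ Finset.range (m + 1), (a + c + 1) :=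
    Fin.sum_univ_eq_sum_range (fun c => a + c + 1) _
  simp only [hc]
  rw [Fin.sum_univ_eq_sum_range (fun a => ∑ c ∈ Finset.range (m + 1), (a + c + 1)) (k + 1),
    Finset.mul_sum]
  simp only [h1, h2]
  ring

theorem le_two_mul_finrank_weyl {d l m k : ℕ} (h : 3 * l + 2 * m + k = d) :
    (k + 1) * (m + 1) * (k + m + 2) ≤
      2 * Module.finrank ℂ (columnTableau d l m k h).weyl := by
  rw [← two_mul_card_sigma]
  refine Nat.mul_le_mul_left 2 ?_
  -- Large enough that `k - a` and `m - c` are genuine digits in base `N`.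
  set N := k + m + 2 with hN
  have hN2 : 2 ≤ N := by omega
  refine (columnTableau d l m k h).card_le_finrank_weyl
    (ι := (a : Fin (k + 1)) × (c : Fin (m + 1)) × Fin (a + c + 1))
    -- For an index (a, c, s), the number s ≤ a + c splits as min s a plus the truncated s - a. The
    -- first part fits into the remaining a columns of height 1, the second into the remaining c
    -- columns of height 2, and the top digit of the degree is s.
    (fun p i => columnWord l m k (k - p.1) (min p.2.2 p.1) (m - p.2.1) (p.2.2 - p.1)
      ((columnTableau d l m k h).equiv i).1 ((columnTableau d l m k h).equiv i).2)
    (fun r => lowerUnipotent r (r ^ N) (r ^ (N ^ 2)))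
    (fun p => columnPoly N (k - p.1) (min p.2.2 p.1) (m - p.2.1) (p.2.2 - p.1))
    (linearIndependent_of_natDegree_injective (fun p => columnPoly_ne_zero hN2 _ _ _ _) ?_)
    fun r p => ?_
  · rintro ⟨⟨a, ha⟩, ⟨c, hc⟩, ⟨s, hs⟩⟩ ⟨⟨a', ha'⟩, ⟨c', hc'⟩, ⟨s', hs'⟩⟩ heq
    simp only [natDegree_columnPoly hN2] at heq
    have hmin (x y : ℕ) : min x y + (x - y) = x := by omega
    rw [hmin, hmin] at heq
    have hdiv {x y x' y' : ℕ} (hx : x < N) (hx' : x' < N) (hxy : x + N * y = x' + N * y') :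
        x = x' ∧ y = y' := by
      have h1 := congrArg (· % N) hxy
      have h2 := congrArg (· / N) hxy
      simp only [Nat.add_mul_mod_self_left, Nat.mod_eq_of_lt hx, Nat.mod_eq_of_lt hx'] at h1
      simp only [Nat.add_mul_div_left _ _ (show 0 < N by omega), Nat.div_eq_of_lt hx,
        Nat.div_eq_of_lt hx', zero_add] at h2
      exact ⟨h1, h2⟩
    obtain ⟨h1, h2⟩ := hdiv (by omega) (by omega) heq
    obtain ⟨h3, rfl⟩ := hdiv (by omega) (by omega) h2
    obtain rfl : a = a' := by omega
    obtain rfl : c = c' := by omega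
    rfl
  · obtain ⟨⟨a, ha⟩, ⟨c, hc⟩, ⟨s, hs⟩⟩ := p
    simp only at hs ⊢
    rw [lowerUnipotent_mulVec_vec h (by omega) (by omega)]
    simp [columnPoly]

/-! ### Letter contents, upper bound for the dimension, and sum of squares -/

theorem sum_word_columnTableau {d l m k : ℕ} (h : 3 * l + 2 * m + k = d) (f : Fin 3 → ℕ) :
    ∑ x, f ((columnTableau d l m k h).word x) =
      l * (f 0 + f 1 + f 2) + m * (f 0 + f 1) + k * f 0 := by
  rw [Tableau.sum_pos (columnTableau d l m k h)]
  simp only [Tableau.word_pos]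
  refine (Fintype.sum_sum_type (M := ℕ) (α₁ := Fin l) (α₂ := Fin m ⊕ Fin k) _).trans ?_
  rw [Fintype.sum_sum_type]
  have h1 : ∀ q : Fin l, ∑ i : Fin 3, f (Fin.castLE
      ((columnTableau d l m k h).height_le (.inl q)) i) = f 0 + f 1 + f 2 := fun q =>
    Fin.sum_univ_three _
  have h2 : ∀ q : Fin m, ∑ i : Fin 2, f (Fin.castLE
      ((columnTableau d l m k h).height_le (.inr (.inl q))) i) = f 0 + f 1 := fun q =>
    Fin.sum_univ_two _
  have h3 : ∀ q : Fin k, ∑ i : Fin 1, f (Fin.castLE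
      ((columnTableau d l m k h).height_le (.inr (.inr q))) i) = f 0 := fun q =>
    Fin.sum_univ_one _
  rw [add_assoc]
  refine congrArg₂ (· + ·) ((Finset.sum_congr rfl fun q _ => h1 q).trans (by simp))
    (congrArg₂ (· + ·) ((Finset.sum_congr rfl fun q _ => h2 q).trans (by simp))
      ((Finset.sum_congr rfl fun q _ => h3 q).trans (by simp)))

theorem exists_perm_of_card_fiber_eq {d : ℕ} {α : Type*} [DecidableEq α] {f g : Fin d → α}
    (h : Multiset.map f Finset.univ.val = Multiset.map g Finset.univ.val) :
    ∃ σ : Equiv.Perm (Fin d), f = g ∘ σ := by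
  have hc (c : α) : Fintype.card {a // f a = c} = Fintype.card {a // g a = c} := by
    have h1 := congrArg (Multiset.count c) h
    simp only [Multiset.count_map] at h1
    simp only [Fintype.card_subtype, Finset.card_def, Finset.filter_val]
    simpa only [eq_comm (a := c)] using h1
  refine ⟨Equiv.ofFiberEquiv fun c => Fintype.equivOfCardEq (hc c), funext fun a => ?_⟩
  exact (Equiv.ofFiberEquiv_map _ a).symm

/-- An invariant matrix is determined by one entry per orbit of pairs of words, and these orbits are
the multisets of size `d` in the 9 pairs of letters. -/
theorem finrank_symMatrixAlgebra_le (d : ℕ) :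
    Module.finrank ℂ (symMatrixAlgebra d) ≤ (d + 8).choose 8 := by
  classical
  have hex (s : Sym (Fin 3 × Fin 3) d) : ∃ f : Fin d → Fin 3 × Fin 3,
      Multiset.map f Finset.univ.val = s.1 := by
    obtain ⟨l, hl⟩ := Quot.exists_rep s.1
    have hlen : l.length = d := by
      have := s.2
      rw [← hl] at this
      exact this
    subst hlen
    refine ⟨l.get, ?_⟩
    rw [← hl, Fin.univ_val_map, List.ofFn_get]
    rfl
  choose r hr using hex
  let L : symMatrixAlgebra d →ₗ[ℂ] (Sym (Fin 3 × Fin 3) d → ℂ) :=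
    { toFun := fun M s => M.1 (fun i => (r s i).1) (fun i => (r s i).2)
      map_add' := fun M N => rfl
      map_smul' := fun c M => rfl }
  have hL : Function.Injective L := by
    rw [← LinearMap.ker_eq_bot, LinearMap.ker_eq_bot']
    intro M hM
    refine Subtype.ext (Matrix.ext fun z w => ?_)
    let s : Sym (Fin 3 × Fin 3) d := ⟨Multiset.map (fun i => (z i, w i)) Finset.univ.val, by simp⟩
    obtain ⟨σ, hσ⟩ := exists_perm_of_card_fiber_eq (hr s)
    have h1 := congrFun hM s
    change M.1 (fun i => (r s i).1) (fun i => (r s i).2) = 0 at h1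
    rw [hσ] at h1
    exact (M.2 σ z w).symm.trans h1
  refine (LinearMap.finrank_le_finrank_of_injective hL).trans ?_
  rw [Module.finrank_fintype_fun_eq_card, Sym.card_sym_eq_choose]
  simp only [Fintype.card_prod, Fintype.card_fin]
  rw [show 3 * 3 + d - 1 = d + 8 by omega, Nat.choose_symm_add]

theorem sum_range_sq_eq (D : ℚ) (K : ℕ) :
    ∑ m ∈ Finset.range K, (1 / 2 * (D - 2 * m + 1) * (m + 1) * (D - m + 2)) ^ 2 =
    (2036 * K + 630 * K ^ 2 - 3290 * K ^ 3 + 630 * K ^ 4 + 1554 * K ^ 5 - 840 * K ^ 6 +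
      120 * K ^ 7 + 3234 * D * K + 3045 * D * K ^ 2 - 3990 * D * K ^ 3 - 1365 * D * K ^ 4 +
      2016 * D * K ^ 5 - 420 * D * K ^ 6 + 1799 * D ^ 2 * K + 2835 * D ^ 2 * K ^ 2 -
      980 * D ^ 2 * K ^ 3 - 1470 * D ^ 2 * K ^ 4 + 546 * D ^ 2 * K ^ 5 + 420 * D ^ 3 * K +
      945 * D ^ 3 * K ^ 2 + 210 * D ^ 3 * K ^ 3 - 315 * D ^ 3 * K ^ 4 + 35 * D ^ 4 * K +
      105 * D ^ 4 * K ^ 2 + 70 * D ^ 4 * K ^ 3) / 840 := by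
  induction K with
  | zero => simp
  | succ K ih =>
    rw [Finset.sum_range_succ, ih]
    push_cast
    ring

theorem choose_add_eight (d : ℕ) : (((d + 8).choose 8 : ℕ) : ℚ) =
    (d + 1) * (d + 2) * (d + 3) * (d + 4) * (d + 5) * (d + 6) * (d + 7) * (d + 8) / 40320 := by
  rw [Nat.cast_choose_eq_ascPochhammer_div]
  simp [ascPochhammer_succ_eval, Nat.factorial]
  ring

/-- The right side is C(d+8, 8) - C(d+5, 8), the second term read as zero for d < 3, so the sum over
`l` in `sum_sum_sq` telescopes in steps of 3. -/
theorem sum_level_sq (d : ℕ) : ∑ m ∈ Finset.range (d / 2 + 1),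
    (1 / 2 * ((d : ℚ) - 2 * m + 1) * (m + 1) * (d - m + 2)) ^ 2 =
    (((d : ℚ) + 1) * (d + 2) * (d + 3) * (d + 4) * (d + 5) * (d + 6) * (d + 7) * (d + 8) -
      (d - 2) * (d - 1) * d * (d + 1) * (d + 2) * (d + 3) * (d + 4) * (d + 5)) / 40320 := by
  rw [sum_range_sq_eq]
  obtain ⟨q, rfl | rfl⟩ := Nat.even_or_odd' d
  · rw [Nat.mul_div_cancel_left q two_pos]
    push_cast
    ring
  · rw [show (2 * q + 1) / 2 = q by omega]
    push_cast
    ring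

theorem sum_sum_sq (d : ℕ) : ∑ l ∈ Finset.range (d / 3 + 1),
    ∑ m ∈ Finset.range ((d - 3 * l) / 2 + 1),
      (1 / 2 * (((d - 3 * l : ℕ) : ℚ) - 2 * m + 1) * (m + 1) * ((d - 3 * l : ℕ) - m + 2)) ^ 2 =
    (((d + 8).choose 8 : ℕ) : ℚ) := by
  simp only [sum_level_sq]
  induction d using Nat.strong_induction_on with
  | _ d ih =>
    obtain hd | hd := lt_or_ge d 3
    · rw [choose_add_eight, Nat.div_eq_of_lt hd, zero_add, Finset.sum_range_one, mul_zero,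
        Nat.sub_zero]
      interval_cases d <;> norm_num
    · obtain ⟨e, rfl⟩ := Nat.exists_eq_add_of_le' hd
      rw [Nat.add_div_right e three_pos, Finset.sum_range_succ']
      simp only [show ∀ l, e + 3 - 3 * (l + 1) = e - 3 * l by omega]
      rw [ih e (by omega), choose_add_eight, choose_add_eight, mul_zero, Nat.sub_zero]
      push_cast
      ring

theorem sum_blockSize_sq (d : ℕ) : ∑ p : BlockIndex d, blockSize d p ^ 2 = (d + 8).choose 8 := by
  rw [← Nat.cast_inj (R := ℚ), ← sum_sum_sq, Nat.cast_sum, Fintype.sum_sigma,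
    ← Fin.sum_univ_eq_sum_range (fun l => ∑ m ∈ Finset.range ((d - 3 * l) / 2 + 1),
      (1 / 2 * (((d - 3 * l : ℕ) : ℚ) - 2 * m + 1) * (m + 1) * ((d - 3 * l : ℕ) - m + 2)) ^ 2)]
  refine Finset.sum_congr rfl fun l _ => ?_
  rw [← Fin.sum_univ_eq_sum_range (fun m =>
      (1 / 2 * (((d - 3 * l : ℕ) : ℚ) - 2 * m + 1) * (m + 1) * ((d - 3 * l : ℕ) - m + 2)) ^ 2)]
  refine Finset.sum_congr rfl fun m _ => ?_
  have hl : 3 * (l : ℕ) ≤ d := by have := l.2; omega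
  rw [Nat.cast_pow, blockSize_cast]
  push_cast [Nat.cast_sub hl]
  ring

/-! ### The block decomposition -/

/-- The tableau attached to a block. -/
noncomputable def blockTableau {d : ℕ} (p : BlockIndex d) : Tableau d :=
  columnTableau d p.1 p.2 (d - 3 * p.1 - 2 * p.2) (by
    have h1 := p.1.2
    have h2 := p.2.2
    omega)

theorem blockTableau_word_injective {d : ℕ} (p q : BlockIndex d) (σ : Equiv.Perm (Fin d))
    (h : (blockTableau p).word = (blockTableau q).word ∘ σ) : p = q := by
  have key (f : Fin 3 → ℕ) := (sum_word_columnTableau _ f).symm.trans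
    (((Finset.sum_congr rfl fun x _ => congrArg f (congrFun h x)).trans
      (Equiv.sum_comp σ fun x => f ((blockTableau q).word x))).trans (sum_word_columnTableau _ f))
  -- The letter 2 occurs l times and the letter 1 occurs l + m times.
  have h1 := key fun a => if a = 2 then 1 else 0
  have h2 := key fun a => if a = 1 then 1 else 0
  simp at h1 h2
  obtain ⟨⟨l, hl⟩, ⟨m, hm⟩⟩ := p
  obtain ⟨⟨l', hl'⟩, ⟨m', hm'⟩⟩ := q
  simp only at h1 h2
  obtain rfl : l = l' := by omega
  obtain rfl : m = m' := by omega
  rfl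

theorem blockSize_le_finrank {d : ℕ} (p : BlockIndex d) :
    blockSize d p ≤ Module.finrank ℂ (blockTableau p).weyl := by
  have h1 := p.1.2
  have h2 := p.2.2
  have h := le_two_mul_finrank_weyl (d := d) (l := p.1) (m := p.2)
    (k := d - 3 * p.1 - 2 * p.2) (by omega)
  rw [show d - 3 * (p.1 : ℕ) - 2 * (p.2 : ℕ) + p.2 + 2 = d - 3 * (p.1 : ℕ) - (p.2 : ℕ) + 2 by
    omega] at h
  exact Nat.div_le_of_le_mul h

/-- With n_p the block sizes, Σ n_p² ≤ Σ (dim W_p)² ≤ dim S ≤ C(d+8, 8) = Σ n_p². Equality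
throughout gives dim W_p = n_p and makes the surjection injective. -/
theorem exists_blockEquiv (d : ℕ) : Nonempty (symMatrixAlgebra d ≃ₐ[ℂ]
    ((p : BlockIndex d) → Matrix (Fin (blockSize d p)) (Fin (blockSize d p)) ℂ)) := by
  set Φ : symMatrixAlgebra d →ₐ[ℂ] ((p : BlockIndex d) → Module.End ℂ (blockTableau p).weyl) :=
    AlgHom.pi fun p => (blockTableau p).weylRep with hΦ
  have hs : Function.Surjective Φ :=
    Tableau.pi_weylRep_surjective blockTableau blockTableau_word_injective
  have hfin : Module.finrank ℂ ((p : BlockIndex d) → Module.End ℂ (blockTableau p).weyl) =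
      ∑ p : BlockIndex d, Module.finrank ℂ (blockTableau p).weyl ^ 2 := by
    have (p : BlockIndex d) : Module.Free ℂ (Module.End ℂ (blockTableau p).weyl) :=
      inferInstance
    rw [Module.finrank_pi_fintype]
    exact Finset.sum_congr rfl fun p _ => by rw [Module.finrank_linearMap, sq]
  have h1 : Module.finrank ℂ ((p : BlockIndex d) → Module.End ℂ (blockTableau p).weyl) ≤
      Module.finrank ℂ (symMatrixAlgebra d) :=
    LinearMap.finrank_le_finrank_of_surjective (f := Φ.toLinearMap) hs
  have h2 := finrank_symMatrixAlgebra_le d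
  have h3 : ∀ p ∈ (Finset.univ : Finset (BlockIndex d)),
      blockSize d p ^ 2 ≤ Module.finrank ℂ (blockTableau p).weyl ^ 2 := fun p _ =>
    Nat.pow_le_pow_left (blockSize_le_finrank p) 2
  have h4 := Finset.sum_le_sum h3
  rw [sum_blockSize_sq] at h4
  have h5 : ∑ p : BlockIndex d, blockSize d p ^ 2 =
      ∑ p : BlockIndex d, Module.finrank ℂ (blockTableau p).weyl ^ 2 := by
    rw [sum_blockSize_sq]; omega
  rw [Finset.sum_eq_sum_iff_of_le h3] at h5
  have h6 (p : BlockIndex d) : Module.finrank ℂ (blockTableau p).weyl = blockSize d p :=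
    (Nat.pow_left_injective two_ne_zero (h5 p (Finset.mem_univ p))).symm
  let E : ((p : BlockIndex d) → Module.End ℂ (blockTableau p).weyl) ≃ₐ[ℂ]
      ((p : BlockIndex d) → Matrix (Fin (blockSize d p)) (Fin (blockSize d p)) ℂ) :=
    AlgEquiv.piCongrRight fun p => algEquivMatrix (Module.finBasisOfFinrankEq ℂ _ (h6 p))
  let Ψ : symMatrixAlgebra d →ₐ[ℂ]
      ((p : BlockIndex d) → Matrix (Fin (blockSize d p)) (Fin (blockSize d p)) ℂ) :=
    E.toAlgHom.comp Φ
  have hΨ : Function.Surjective Ψ := E.surjective.comp hs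
  have h7 : Module.finrank ℂ (symMatrixAlgebra d) = Module.finrank ℂ
      ((p : BlockIndex d) → Matrix (Fin (blockSize d p)) (Fin (blockSize d p)) ℂ) := by
    have h8 : Module.finrank ℂ
        ((p : BlockIndex d) → Matrix (Fin (blockSize d p)) (Fin (blockSize d p)) ℂ) =
        ∑ p : BlockIndex d, blockSize d p ^ 2 := by
      rw [Module.finrank_pi_fintype]
      exact Finset.sum_congr rfl fun p _ => by simp [Module.finrank_matrix, sq]
    rw [h8, sum_blockSize_sq]
    omega
  have hi : Function.Injective Ψ :=
    (LinearMap.injective_iff_surjective_of_finrank_eq_finrank (f := Ψ.toLinearMap) h7).2 hΨ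
  exact ⟨AlgEquiv.ofBijective Ψ ⟨hi, hΨ⟩⟩

end HammingDigraph

theorem theorem1p4 (d : ℕ) (x : Fin d → ZMod 3) :
    Nonempty (HammingDigraph.terwilligerAlgebra (HammingDigraph.hammingDigraph d) x ≃ₐ[ℂ]
      HammingDigraph.symTensorAlgebra d) ∧
    Nonempty (HammingDigraph.symTensorAlgebra d ≃ₐ[ℂ]
      ((p : HammingDigraph.BlockIndex d) →
        Matrix (Fin (HammingDigraph.blockSize d p)) (Fin (HammingDigraph.blockSize d p)) ℂ)) ∧
    Nonempty (HammingDigraph.terwilligerAlgebra (HammingDigraph.hammingDigraph d) x ≃ₐ[ℂ]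
      ((p : HammingDigraph.BlockIndex d) →
        Matrix (Fin (HammingDigraph.blockSize d p)) (Fin (HammingDigraph.blockSize d p)) ℂ)) := by
  obtain ⟨e⟩ := HammingDigraph.exists_blockEquiv d
  exact ⟨⟨(HammingDigraph.terwilligerEquiv x).trans (HammingDigraph.symTensorEquiv d).symm⟩,
    ⟨(HammingDigraph.symTensorEquiv d).trans e⟩, ⟨(HammingDigraph.terwilligerEquiv x).trans e⟩⟩
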